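/- Notation. Write $\epsilon_{ijk}$ for the Levi-Civita symbol ($i,j,k\in\{1,2,3\}$), and let $X_1,X_2,X_3$ be the standard basis of $\mathfrak{so}(3)$, $(X_i)_{jk}=-\epsilon_{ijk}$, so that a representation $\rho$ of $\mathfrak{so}(3)$ on $\mathbb{C}^N$ is the same thing as a triple $Y_i=\rho(X_i)$ of $N\times N$ matrices with $[Y_i,Y_j]=\sum_k\epsilon_{ijk}Y_k$. For $m\geq 1$ let $(V_m,\rho_m)$ be the irreducible complex representation of $\mathfrak{so}(3)$ of dimension $m$, realised on $V_m=\mathbb{C}^m$ by skew-Hermitian matrices $Y_i^m:=\rho_m(X_i)$. Let $B^m=(B_1^m,B_2^m,B_3^m)$ be a triple of $(m+2)\times m$ matrices, viewed as maps $V_m\to V_{m+2}$, that is $\mathfrak{so}(3)$-invariant, i.e. $Y_j^{m+2}B_k^m-B_k^mY_j^m=\sum_i\epsilon_{ijk}B_i^m$ for all $j,k$, and normalised by $\sum_i\mathrm{tr}\big(B_i^m(B_i^m)^*\big)=m+2$ (equivalently $\sum_iB_i^m(B_i^m)^*=\mathbb{1}_{m+2}$); such a triple is unique up to a factor in $\mathrm{U}(1)$.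 Theorem. Let $n,k\geq 1$ and $N=\sum_{a=0}^k(n+2a)$. Let $I\subseteq\mathbb{R}$ be an open interval and let $\mathcal{T}=(T_1,T_2,T_3):I\to\mathfrak{su}(N)^{\oplus 3}$ be a solution of Nahm's equations $$\dot T_1=[T_2,T_3],\qquad \dot T_2=[T_3,T_1],\qquad \dot T_3=[T_1,T_2]$$ that is spherically symmetric: for every $A\in\mathrm{SO}(3)$ there is $U_A\in\mathrm{SU}(N)$ with $\sum_jA_{ij}T_j(t)=U_A^{-1}T_i(t)U_A$ for all $i$ and all $t\in I$. Let $Y_1,Y_2,Y_3\in\mathfrak{su}(N)$ be generators of the symmetry, that is $[Y_i,T_j(t)]=\sum_k\epsilon_{ijk}T_k(t)$ for all $i,j$ and all $t\in I$. Suppose that $[Y_i,Y_j]=\sum_k\epsilon_{ijk}Y_k$ and that the representation $\rho(X_i)=Y_i$ of $\mathfrak{so}(3)$ on $\mathbb{C}^N$ satisfies $$(\mathbb{C}^N,\rho)\simeq V_{n+2k}\oplus\cdots\oplus V_{n+2}\oplus V_n .$$ Then there are a constant gauge $U\in\mathrm{SU}(N)$ and functions $f_0,\ldots,f_k,g_0,\ldots,g_{k-1}:I\to\mathbb{R}$,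 all real analytic, such that for all $i\in\{1,2,3\}$ one has $Y_i=U\,\mathrm{diag}\big(Y_i^{n+2k},\ldots,Y_i^{n+2},Y_i^n\big)\,U^{-1}$ and, for all $t\in I$, $$U^{-1}T_i(t)\,U=\begin{pmatrix} f_k Y_i^{n+2k} & g_{k-1}B_i^{n+2(k-1)} & 0 & \cdots & 0\\ -g_{k-1}\big(B_i^{n+2(k-1)}\big)^* & f_{k-1}Y_i^{n+2(k-1)} & g_{k-2}B_i^{n+2(k-2)} & & \vdots\\ 0 & -g_{k-2}\big(B_i^{n+2(k-2)}\big)^* & \ddots & \ddots & 0\\ \vdots & & \ddots & \ddots & g_0B_i^n\\ 0 & \cdots & 0 & -g_0\big(B_i^n\big)^* & f_0Y_i^n \end{pmatrix}$$ (the functions being evaluated at $t$). Put $g_{-1}=g_k\equiv 0$. Then the following hold on $I$. If $n=1$, then $Y_1^1=Y_2^1=Y_3^1=0$ (so that $f_0$ is irrelevant) and $$\dot f_a=f_a^2+\frac1a\,g_{a-1}^2-\frac{2a+3}{(2a+1)(a+1)}\,g_a^2\quad(1\leq a\leq k),\qquad \dot g_a=\big((a+2)f_{a+1}-a f_a\big)g_a\quad(0\leq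 a\leq k-1).$$ If $n\geq 2$, then $$\dot f_a=f_a^2+\frac{2}{n+2a-1}\,g_{a-1}^2-\frac{2(n+2a+2)}{(n+2a)(n+2a+1)}\,g_a^2\quad(0\leq a\leq k),$$ $$\dot g_a=\Big(\frac{n+2a+3}{2}f_{a+1}-\frac{n+2a-1}{2}f_a\Big)g_a\quad(0\leq a\leq k-1).$$ -/

import Mathlib

open Matrix

noncomputable section

namespace NahmChain

/-- The Levi-Civita symbol; the indices `1, 2, 3` are written `0, 1, 2`, added modulo three. -/
def eps (i j k : Fin 3) : ℂ :=
  if j = i + 1 ∧ k = i + 2 then 1 else if j = i + 2 ∧ k = i + 1 then -1 else 0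

/-- `M ∈ 𝔰𝔲(N)`: skew-Hermitian and traceless. -/
def IsSu {N : ℕ} (M : Matrix (Fin N) (Fin N) ℂ) : Prop :=
  Mᴴ = -M ∧ M.trace = 0

/-- Nahm's equations on `I`: `T₁' = [T₂, T₃]`, `T₂' = [T₃, T₁]`, `T₃' = [T₁, T₂]`, the derivative
of a matrix-valued function being taken entry by entry. -/
def SolvesNahm {N : ℕ} (I : Set ℝ) (T : Fin 3 → ℝ → Matrix (Fin N) (Fin N) ℂ) : Prop :=
  ∀ t ∈ I, ∀ i p q, HasDerivAt (fun s => T i s p q)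
    ((T (i + 1) t * T (i + 2) t - T (i + 2) t * T (i + 1) t) p q) t

/-- Spherical symmetry: every rotation of the triple is undone by some (time independent) gauge
transformation, `ᴬT = U⁻¹ T U`. -/
def SphericallySymmetric {N : ℕ} (I : Set ℝ) (T : Fin 3 → ℝ → Matrix (Fin N) (Fin N) ℂ) : Prop :=
  ∀ A ∈ specialOrthogonalGroup (Fin 3) ℝ, ∃ U ∈ specialUnitaryGroup (Fin N) ℂ,
    ∀ t ∈ I, ∀ i, ∑ j, (A i j : ℂ) • T j t = U⁻¹ * T i t * U

/-- The triple `Y` consists of generators of the spherical symmetry of `T`: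
`Y_i ∈ 𝔰𝔲(N)` and `[Y_i, T_j] = ∑_k ε_{ijk} T_k`. -/
def IsGenerators {N : ℕ} (I : Set ℝ) (T : Fin 3 → ℝ → Matrix (Fin N) (Fin N) ℂ)
    (Y : Fin 3 → Matrix (Fin N) (Fin N) ℂ) : Prop :=
  (∀ i, IsSu (Y i)) ∧
    ∀ t ∈ I, ∀ i j, Y i * T j t - T j t * Y i = ∑ k, eps i j k • T k t

/-- The triple `Y` satisfies the `𝔰𝔬(3)` commutation relations `[Y_i, Y_j] = ∑_k ε_{ijk} Y_k`.
Since the standard basis of `𝔰𝔬(3)` satisfies the same relations, such a triple is the same thing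
as a representation `ρ` of `𝔰𝔬(3)`, with `Y_i = ρ(X_i)`. -/
def IsSo3Rep {ι : Type*} [Fintype ι] (Y : Fin 3 → Matrix ι ι ℂ) : Prop :=
  ∀ i j, Y i * Y j - Y j * Y i = ∑ k, eps i j k • Y k

/-- Isomorphism of complex representations of `𝔰𝔬(3)` given by triples of matrices. -/
def RepEquiv {ι κ : Type*} [Fintype ι] [Fintype κ]
    (Y : Fin 3 → Matrix ι ι ℂ) (Z : Fin 3 → Matrix κ κ ℂ) : Prop :=
  ∃ P : (ι → ℂ) ≃ₗ[ℂ] (κ → ℂ), ∀ i v, P (Y i *ᵥ v) = Z i *ᵥ P v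

/-- The raising operator `J₊ = J₁ + i J₂` of spin `(m - 1) / 2` in the orthonormal weight basis,
ordered by decreasing weight: `J₊ e_q = √(q (m - q)) e_{q - 1}`. -/
def spinUp (m : ℕ) : Matrix (Fin m) (Fin m) ℂ :=
  of fun p q => if (q : ℕ) = p + 1 then ((√((q : ℝ) * ((m : ℝ) - q)) : ℝ) : ℂ) else 0

/-- The irreducible `m`-dimensional representation of `𝔰𝔬(3)`, realised by the standard spin
matrices of spin `(m - 1) / 2`: the triple `-i J₁, -i J₂, -i J₃`. -/
def spin (m : ℕ) : Fin 3 → Matrix (Fin m) (Fin m) ℂ :=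
  ![-(Complex.I / 2) • (spinUp m + (spinUp m)ᴴ),
    -(1 / 2 : ℂ) • (spinUp m - (spinUp m)ᴴ),
    -Complex.I • diagonal fun p : Fin m => ((m : ℂ) - 1) / 2 - (p : ℕ)]

/-- `Y` is the triple `Y_i = ρ_m(X_i)` of a unitary model `ρ_m` on `ℂᵐ` of the irreducible
`m`-dimensional representation of `𝔰𝔬(3)`. -/
def IsIrrep (m : ℕ) (Y : Fin 3 → Matrix (Fin m) (Fin m) ℂ) : Prop :=
  (∀ i, (Y i)ᴴ = -Y i) ∧ RepEquiv Y (spin m)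

/-- `B` is a triple of maps `V_m → V_{m+2}` that is invariant under `𝔰𝔬(3)`, that is
`Y⁺_j B_k - B_k Y⁻_j = ∑_i ε_{ijk} B_i`, normalised by `∑ tr (B_i B_i^*) = m + 2`. This is the
normalisation `∑ B_i B_i^* = 1`, because that sum is a multiple of the identity. -/
def IsInvariantTriple (m : ℕ) (Yp : Fin 3 → Matrix (Fin (m + 2)) (Fin (m + 2)) ℂ)
    (Ym : Fin 3 → Matrix (Fin m) (Fin m) ℂ)
    (B : Fin 3 → Matrix (Fin (m + 2)) (Fin m) ℂ) : Prop :=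
  (∀ j k, Yp j * B k - B k * Ym j = ∑ i, eps i j k • B i) ∧
    ∑ i, (B i * (B i)ᴴ).trace = (m : ℂ) + 2

/-- The index set of the block decomposition `V_n ⊕ V_{n+2} ⊕ ⋯ ⊕ V_{n+2k}`: the element
`⟨a, p⟩` is the `p`-th basis vector of `V_{n+2a}`. -/
abbrev Idx (n k : ℕ) : Type := (a : Fin (k + 1)) × Fin (n + 2 * a)

/-- The direct sum `V_{n+2k} ⊕ ⋯ ⊕ V_{n+2} ⊕ V_n`, as a triple of block diagonal matrices. -/
def chainRep (n k : ℕ) (Y : (m : ℕ) → Fin 3 → Matrix (Fin m) (Fin m) ℂ) (i : Fin 3) :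
    Matrix (Idx n k) (Idx n k) ℂ :=
  blockDiagonal' fun a : Fin (k + 1) => Y (n + 2 * a) i

/-- The block tridiagonal matrix with diagonal blocks `f_a Y_i^{n+2a}`, with block
`g_a B_i^{n+2a}` in position `(a + 1, a)` and block `-g_a (B_i^{n+2a})^*` in position
`(a, a + 1)`, for given real numbers `f_a` and `g_a`. -/
def chainMatrix (n k : ℕ) (Y : (m : ℕ) → Fin 3 → Matrix (Fin m) (Fin m) ℂ)
    (B : (m : ℕ) → Fin 3 → Matrix (Fin (m + 2)) (Fin m) ℂ) (f g : ℕ → ℝ) (i : Fin 3) :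
    Matrix (Idx n k) (Idx n k) ℂ :=
  of fun x y =>
    if h : (y.1 : ℕ) = x.1 then
      (f x.1 : ℂ) * Y (n + 2 * x.1) i x.2 (Fin.cast (by rw [h]) y.2)
    else if h : (x.1 : ℕ) = y.1 + 1 then
      (g y.1 : ℂ) * B (n + 2 * y.1) i (Fin.cast (by rw [h]; rfl) x.2) y.2
    else if h : (y.1 : ℕ) = x.1 + 1 then
      -(g x.1 : ℂ) * (B (n + 2 * x.1) i)ᴴ x.2 (Fin.cast (by rw [h]; rfl) y.2)
    else 0

end NahmChain

end

/-!
The generators and the solution are triples of matrices `S` satisfying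
`Y_j S_k - S_k Z_j = ∑_i ε_{ijk} S_i` for representations `Y` and `Z`; such an `S` is called a vector
operator (`IsVectorOp`). Nahm's equations say `T' = T × T` for the cross product `cross`, the cross
product of vector operators is a vector operator, and their dot product is an intertwiner. Hence
everything follows from the classification of the vector operators between the irreducible
representations `V_a` and `V_b`, and from a few constants.

The classification comes from the Casimir operator `Y · Y`, which is `-(m² - 1) / 4` on `V_m`. The
commutator of a vector operator with the Casimir operator (`IsVectorOp.casimir_sub`) shows that
`Y × S` is a known multiple of `S`, and `Y · S` vanishes for `a ≠ b`. The identity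
`Y × (Y × S) = Y (Y · S) + Y × S - (Y · Y) S` (`cross_cross`) then gives a quadratic equation for
that multiple, which fails unless `a = b ± 2` (`IsIrrep.vectorOp_eq_zero`). For `a = b`, Schur's
lemma and the same identity give `S = c Y` (`IsIrrep.exists_eq_smul`). For `a = b + 2`, the raising
component of `S` is determined by a single entry in the weight bases, so `S = c B`
(`IsInvariantTriple.exists_eq_smul`). The constants in `Y × B`, `B × Y`, `B × B^*` and `B^* × B`
follow from the Casimir values, from `Y · (B × B^*) = (Y × B) · B^*`, and from the normalisation
`B · B^* = 1`.

An isomorphism from `V_{n+2k} ⊕ ⋯ ⊕ V_n` to the given representation becomes unitary after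
rescaling on each summand, since by Schur's lemma its Gram matrix is a scalar on each summand. In
that gauge the solution is block tridiagonal with coefficients `f_a` and `g_a`, where `f_a` is real
because the matrices are skew-Hermitian, while `g_a` may be complex. Comparing the blocks of
`T' = T × T` gives the differential equations, with `|g_a|²` for `g_a²`. The equation for `g_a` is
linear with a real coefficient, so a constant phase on each summand that makes all `g_a` real at
one time makes them real on the whole interval.

The coefficients are linear functionals of the solution, so they are analytic because the solution
is (`analyticAt_of_hasDerivAt_quadratic`): for `y' = Q(y, y)` the Taylor coefficients `c_j(u)` of
`y` at `u` satisfy a recursion that bounds them geometrically, and the derivative in `u` of the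
Taylor polynomial `∑_{j ≤ n} (s - u)^j c_j(u)` telescopes to a single small term.
-/

noncomputable section

namespace NahmChain

/-! ### Vector operators -/

section

variable {ι κ μ : Type*} [Fintype ι] [Fintype κ] [Fintype μ]

/-- `S` is a vector operator from the representation `Z` to the representation `Y`. The generators
of a representation are a vector operator from it to itself; since `eps` is cyclic, the order of its
indices agrees with that in `IsGenerators`. -/
def IsVectorOp (Y : Fin 3 → Matrix ι ι ℂ) (Z : Fin 3 → Matrix κ κ ℂ)
    (S : Fin 3 → Matrix ι κ ℂ) : Prop :=
  ∀ j k, Y j * S k - S k * Z j = ∑ i, eps i j k • S i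

/-- The cross product of two triples of matrices. -/
def cross (S : Fin 3 → Matrix ι κ ℂ) (S' : Fin 3 → Matrix κ μ ℂ) (i : Fin 3) : Matrix ι μ ℂ :=
  S (i + 1) * S' (i + 2) - S (i + 2) * S' (i + 1)

/-- The dot product of two triples of matrices; `dot Y Y` is the Casimir operator of `Y`. -/
def dot (S : Fin 3 → Matrix ι κ ℂ) (S' : Fin 3 → Matrix κ μ ℂ) : Matrix ι μ ℂ :=
  ∑ i, S i * S' i

variable {Y : Fin 3 → Matrix ι ι ℂ} {Z : Fin 3 → Matrix κ κ ℂ} {W : Fin 3 → Matrix μ μ ℂ}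
  {S : Fin 3 → Matrix ι κ ℂ} {S' : Fin 3 → Matrix κ μ ℂ}

/-- The relations of a vector operator, written out in a form that moves the operators of the
representation to the right. -/
theorem isVectorOp_iff : IsVectorOp Y Z S ↔
    (Y 0 * S 0 = S 0 * Z 0 ∧ Y 0 * S 1 = S 1 * Z 0 + S 2 ∧ Y 0 * S 2 = S 2 * Z 0 - S 1) ∧
    (Y 1 * S 0 = S 0 * Z 1 - S 2 ∧ Y 1 * S 1 = S 1 * Z 1 ∧ Y 1 * S 2 = S 2 * Z 1 + S 0) ∧
    (Y 2 * S 0 = S 0 * Z 2 + S 1 ∧ Y 2 * S 1 = S 1 * Z 2 - S 0 ∧ Y 2 * S 2 = S 2 * Z 2) := by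
  simp [IsVectorOp, Fin.forall_fin_succ, Fin.sum_univ_three, eps, sub_eq_iff_eq_add,
    neg_add_eq_sub, add_comm (S _) (S _ * Z _)]

theorem IsVectorOp.smul (h : IsVectorOp Y Z S) (c : ℂ) : IsVectorOp Y Z (c • S) := by
  intro j k
  simp [← smul_sub, h j k, Finset.smul_sum, smul_comm c]

theorem IsVectorOp.sub {S₁ : Fin 3 → Matrix ι κ ℂ} (h : IsVectorOp Y Z S)
    (h' : IsVectorOp Y Z S₁) : IsVectorOp Y Z (S - S₁) := by
  intro j k
  simp only [Pi.sub_apply, Matrix.mul_sub, Matrix.sub_mul, smul_sub, Finset.sum_sub_distrib,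
    ← h j k, ← h' j k]
  abel

theorem IsVectorOp.conjTranspose (h : IsVectorOp Y Z S) (hY : ∀ i, (Y i)ᴴ = -Y i)
    (hZ : ∀ i, (Z i)ᴴ = -Z i) : IsVectorOp Z Y (fun i => (S i)ᴴ) := by
  intro j k
  have := congrArg Matrix.conjTranspose (h j k)
  have he : ∀ i, star (eps i j k) = eps i j k := fun i => by
    unfold eps; split_ifs <;> simp
  simp only [conjTranspose_sub, conjTranspose_mul, hY, hZ, conjTranspose_sum,
    conjTranspose_smul, he] at this
  rw [← this]
  simp only [Matrix.mul_neg, Matrix.neg_mul]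
  abel

/-- Intertwiners carry vector operators to vector operators. -/
theorem IsVectorOp.mul_mul {ι' κ' : Type*} [Fintype ι'] [Fintype κ']
    {Y' : Fin 3 → Matrix ι' ι' ℂ} {Z' : Fin 3 → Matrix κ' κ' ℂ} (h : IsVectorOp Y Z S)
    {P : Matrix ι' ι ℂ} {Q : Matrix κ κ' ℂ} (hP : ∀ i, P * Y i = Y' i * P)
    (hQ : ∀ i, Z i * Q = Q * Z' i) : IsVectorOp Y' Z' (fun i => P * S i * Q) := by
  intro j k
  have := congrArg (fun M => P * M * Q) (h j k)
  simp only [Matrix.mul_sub, Matrix.sub_mul, Matrix.mul_sum, Matrix.sum_mul, Matrix.mul_smul,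
    Matrix.smul_mul] at this
  rw [← this, Matrix.mul_assoc (P * S k), ← hQ j, ← Matrix.mul_assoc, ← Matrix.mul_assoc, ← hP j]
  simp only [Matrix.mul_assoc]

/-- The dot product of vector operators is an intertwiner. -/
theorem IsVectorOp.dot_comm (h : IsVectorOp Y Z S) (h' : IsVectorOp Z W S') (j : Fin 3) :
    Y j * dot S S' = dot S S' * W j := by
  obtain ⟨⟨h1, h2, h3⟩, ⟨h4, h5, h6⟩, h7, h8, h9⟩ := isVectorOp_iff.1 h
  obtain ⟨⟨k1, k2, k3⟩, ⟨k4, k5, k6⟩, k7, k8, k9⟩ := isVectorOp_iff.1 h'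
  fin_cases j <;>
  simp [dot, Fin.sum_univ_three, Matrix.mul_add, ← Matrix.mul_assoc, h1, h2, h3, h4, h5, h6, h7,
    h8, h9, Matrix.add_mul, Matrix.sub_mul] <;>
  simp [Matrix.mul_assoc, k1, k2, k3, k4, k5, k6, k7, k8, k9, Matrix.mul_add, Matrix.mul_sub] <;>
  abel

/-- The cross product of vector operators is a vector operator. -/
theorem IsVectorOp.cross (h : IsVectorOp Y Z S) (h' : IsVectorOp Z W S') :
    IsVectorOp Y W (cross S S') := by
  obtain ⟨⟨h1, h2, h3⟩, ⟨h4, h5, h6⟩, h7, h8, h9⟩ := isVectorOp_iff.1 h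
  obtain ⟨⟨k1, k2, k3⟩, ⟨k4, k5, k6⟩, k7, k8, k9⟩ := isVectorOp_iff.1 h'
  refine isVectorOp_iff.2 ?_
  simp only [NahmChain.cross, Matrix.mul_sub, ← Matrix.mul_assoc, Fin.isValue, zero_add,
    Fin.reduceAdd, h1, h2, h3, h4, h5, h6, h7, h8, h9, Matrix.add_mul, Matrix.sub_mul]
  simp only [Matrix.mul_assoc, k1, k2, k3, k4, k5, k6, k7, k8, k9, Matrix.mul_add,
    Matrix.mul_sub]
  refine ⟨⟨?_, ?_, ?_⟩, ⟨?_, ?_, ?_⟩, ?_, ?_, ?_⟩ <;> abel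

theorem IsVectorOp.cross_right (h : IsVectorOp Y Z S) :
    NahmChain.cross S Z = (2 : ℂ) • S - NahmChain.cross Y S := by
  obtain ⟨⟨h1, h2, h3⟩, ⟨h4, h5, h6⟩, h7, h8, h9⟩ := isVectorOp_iff.1 h
  funext i
  fin_cases i <;> simp [NahmChain.cross, h2, h3, h4, h6, h7, h8] <;> module

/-- The commutator of a vector operator with the Casimir operator. -/
theorem IsVectorOp.casimir_sub (h : IsVectorOp Y Z S) (i : Fin 3) :
    dot Y Y * S i - S i * dot Z Z = (2 : ℂ) • (S i - NahmChain.cross Y S i) := by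
  obtain ⟨⟨h1, h2, h3⟩, ⟨h4, h5, h6⟩, h7, h8, h9⟩ := isVectorOp_iff.1 h
  have r : ∀ j, Y j * Y j * S i = Y j * (Y j * S i) := fun j => Matrix.mul_assoc _ _ _
  fin_cases i <;>
  simp only [dot, Fin.sum_univ_three, Matrix.mul_add, Matrix.add_mul, NahmChain.cross,
    Fin.isValue, Fin.zero_eta, Fin.mk_one, Fin.reduceFinMk, zero_add, Fin.reduceAdd,
    Matrix.mul_assoc, h1, h2, h3, h4, h5, h6, h7, h8, h9, Matrix.mul_sub] <;>
  simp only [← Matrix.mul_assoc, h1, h2, h3, h4, h5, h6, h7, h8, h9, Matrix.add_mul,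
    Matrix.sub_mul] <;> module

omit [Fintype κ] in
/-- The double cross product identity, for a triple with the commutation relations of `𝔰𝔬(3)`. -/
theorem cross_cross (hY : IsVectorOp Y Y Y) (i : Fin 3) :
    cross Y (cross Y S) i = Y i * dot Y S + cross Y S i - dot Y Y * S i := by
  obtain ⟨⟨h1, h2, h3⟩, ⟨h4, h5, h6⟩, h7, h8, h9⟩ := isVectorOp_iff.1 hY
  fin_cases i <;>
  simp only [dot, Fin.sum_univ_three, Matrix.mul_add, Matrix.add_mul, NahmChain.cross,
    Fin.isValue, Fin.zero_eta, Fin.mk_one, Fin.reduceFinMk, zero_add, Fin.reduceAdd,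
    Matrix.mul_sub, ← Matrix.mul_assoc, h2, h3, h6, Matrix.sub_mul] <;>
  abel

omit [Fintype ι] in
theorem dot_cross {ν : Type*} [Fintype ν] (S : Fin 3 → Matrix ι κ ℂ)
    (S' : Fin 3 → Matrix κ μ ℂ) (S'' : Fin 3 → Matrix μ ν ℂ) :
    dot S (cross S' S'') = dot (cross S S') S'' := by
  simp only [dot, Fin.sum_univ_three, NahmChain.cross, Fin.isValue, zero_add, Fin.reduceAdd,
    Matrix.mul_sub, Matrix.sub_mul, ← Matrix.mul_assoc]
  abel

end

/-! ### The spin matrices -/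

theorem spinUp_apply_succ {m : ℕ} (p q : Fin m) (h : (q : ℕ) = p + 1) :
    spinUp m p q = ((√((q : ℝ) * ((m : ℝ) - q)) : ℝ) : ℂ) := by
  simp only [spinUp, of_apply, if_pos h]

theorem spinUp_apply_ne_zero {m : ℕ} (p q : Fin m) (h : (q : ℕ) = p + 1) :
    spinUp m p q ≠ 0 := by
  rw [spinUp_apply_succ p q h]
  have h1 : (0 : ℝ) < q := by rw [h]; positivity
  have h2 : (0 : ℝ) < (m : ℝ) - q := sub_pos.2 (by exact_mod_cast q.2)
  exact_mod_cast (Real.sqrt_pos.2 (mul_pos h1 h2)).ne'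

/-- The diagonal matrix of weights, `J₃`. -/
def weight (m : ℕ) : Matrix (Fin m) (Fin m) ℂ :=
  diagonal fun p : Fin m => ((m : ℂ) - 1) / 2 - (p : ℕ)

theorem spinUp_mul_conjTranspose (m : ℕ) :
    spinUp m * (spinUp m)ᴴ =
      diagonal fun p : Fin m => ((p : ℕ) + 1 : ℂ) * ((m : ℂ) - ((p : ℕ) + 1)) := by
  ext p q
  have key : ∀ r : Fin m, spinUp m p r * star (spinUp m q r) =
      if (r : ℕ) = p + 1 then (if p = q then ((p : ℕ) + 1 : ℂ) * ((m : ℂ) - ((p : ℕ) + 1)) else 0)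
      else 0 := by
    intro r
    by_cases hr : (r : ℕ) = p + 1
    · by_cases hpq : p = q
      · subst hpq
        have h2 : (0 : ℝ) ≤ (r : ℝ) * ((m : ℝ) - r) :=
          mul_nonneg (by positivity) (sub_nonneg.2 (by exact_mod_cast r.2.le))
        rw [spinUp_apply_succ p r hr, if_pos hr, if_pos rfl, Complex.star_def, Complex.conj_ofReal,
          ← Complex.ofReal_mul, Real.mul_self_sqrt h2, hr]
        push_cast; ring
      · have : ¬ (r : ℕ) = q + 1 := fun h => hpq (Fin.ext (by omega))
        simp [spinUp, this, hpq]
    · simp [spinUp, hr]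
  simp only [mul_apply, conjTranspose_apply, key, diagonal_apply]
  by_cases hp : (p : ℕ) + 1 < m
  · rw [Finset.sum_eq_single ⟨p + 1, hp⟩]
    · simp
    · intro b _ hb
      rw [if_neg]
      exact fun h => hb (Fin.ext h)
    · simp
  · have h0 : ((m : ℂ) - ((p : ℕ) + 1)) = 0 := by
      have : m = p + 1 := by omega
      rw [sub_eq_zero]; exact_mod_cast this
    simp [h0]

theorem conjTranspose_mul_spinUp (m : ℕ) :
    (spinUp m)ᴴ * spinUp m = diagonal fun p : Fin m => ((p : ℕ) : ℂ) * ((m : ℂ) - (p : ℕ)) := by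
  ext p q
  have key : ∀ r : Fin m, star (spinUp m r p) * spinUp m r q =
      if (p : ℕ) = r + 1 then (if p = q then ((p : ℕ) : ℂ) * ((m : ℂ) - (p : ℕ)) else 0)
      else 0 := by
    intro r
    by_cases hr : (p : ℕ) = r + 1
    · by_cases hpq : p = q
      · subst hpq
        have h2 : (0 : ℝ) ≤ (p : ℝ) * ((m : ℝ) - p) :=
          mul_nonneg (by positivity) (sub_nonneg.2 (by exact_mod_cast p.2.le))
        rw [spinUp_apply_succ r p hr, if_pos hr, if_pos rfl, Complex.star_def, Complex.conj_ofReal,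
          ← Complex.ofReal_mul, Real.mul_self_sqrt h2]
        push_cast; ring
      · have : ¬ (q : ℕ) = r + 1 := fun h => hpq (Fin.ext (by omega))
        simp [spinUp, this, hpq]
    · simp [spinUp, hr]
  simp only [mul_apply, conjTranspose_apply, key, diagonal_apply]
  by_cases hp : (p : ℕ) = 0
  · simp [hp]
  · rw [Finset.sum_eq_single ⟨p - 1, by omega⟩]
    · rw [if_pos]
      change (p : ℕ) = p - 1 + 1
      omega
    · intro b _ hb
      rw [if_neg]
      exact fun h => hb (Fin.ext (by change (b : ℕ) = p - 1; omega))
    · simp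

theorem weight_mul_spinUp (m : ℕ) : weight m * spinUp m = spinUp m * weight m + spinUp m := by
  ext p q
  by_cases h : (q : ℕ) = p + 1
  · simp only [weight, diagonal_mul, Matrix.add_apply, mul_diagonal, h]
    push_cast; ring
  · simp [weight, spinUp, h]

theorem weight_mul_conjTranspose_spinUp (m : ℕ) :
    weight m * (spinUp m)ᴴ = (spinUp m)ᴴ * weight m - (spinUp m)ᴴ := by
  ext p q
  by_cases h : (p : ℕ) = q + 1
  · simp only [weight, diagonal_mul, Matrix.sub_apply, mul_diagonal, h]
    push_cast; ring
  · simp [weight, spinUp, h]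

theorem spinUp_commutator (m : ℕ) :
    spinUp m * (spinUp m)ᴴ = (spinUp m)ᴴ * spinUp m + (2 : ℂ) • weight m := by
  rw [spinUp_mul_conjTranspose, conjTranspose_mul_spinUp]
  ext p q
  by_cases h : p = q
  · subst h
    simp [weight]
    ring
  · simp [weight, h]

theorem spin_zero (m : ℕ) : spin m 0 = -(Complex.I / 2) • (spinUp m + (spinUp m)ᴴ) := rfl

theorem spin_one (m : ℕ) : spin m 1 = -(1 / 2 : ℂ) • (spinUp m - (spinUp m)ᴴ) := rfl

theorem spin_two (m : ℕ) : spin m 2 = -Complex.I • weight m := rfl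

theorem spin_isVectorOp (m : ℕ) : IsVectorOp (spin m) (spin m) (spin m) := by
  have h1 := weight_mul_spinUp m
  have h2 := weight_mul_conjTranspose_spinUp m
  have h3 := spinUp_commutator m
  rw [isVectorOp_iff, spin_zero, spin_one, spin_two]
  refine ⟨⟨?_, ?_, ?_⟩, ⟨?_, ?_, ?_⟩, ?_, ?_, ?_⟩ <;>
  simp only [Matrix.mul_add, Matrix.mul_sub, Matrix.add_mul, Matrix.sub_mul, Matrix.smul_mul,
    Matrix.mul_smul, h1, h2, h3, smul_add, smul_sub, smul_smul] <;>
  match_scalars <;> grind [Complex.I_sq]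

theorem spin_casimir (m : ℕ) :
    dot (spin m) (spin m) = (-(((m : ℂ) ^ 2 - 1) / 4)) • (1 : Matrix (Fin m) (Fin m) ℂ) := by
  have h1 := spinUp_mul_conjTranspose m
  have h2 := conjTranspose_mul_spinUp m
  have h : dot (spin m) (spin m) = (-(1 / 2 : ℂ)) • (spinUp m * (spinUp m)ᴴ) +
      (-(1 / 2 : ℂ)) • ((spinUp m)ᴴ * spinUp m) - weight m * weight m := by
    simp only [dot, Fin.sum_univ_three, spin_zero, spin_one, spin_two, Matrix.mul_add,
      Matrix.mul_sub, Matrix.add_mul, Matrix.sub_mul, Matrix.smul_mul,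
      Matrix.mul_smul, smul_add, smul_sub, smul_smul]
    match_scalars <;> grind [Complex.I_sq]
  rw [h, h1, h2]
  ext p q
  by_cases hpq : p = q
  · subst hpq
    simp [weight]
    ring
  · simp [weight, hpq]

/-- Schur's lemma for the spin matrices: a matrix that commutes with `J₃` is diagonal, because the
weights are distinct, and if it also commutes with `J₊`, its diagonal entries agree. -/
theorem eq_smul_one_of_comm_spin {m : ℕ} {X : Matrix (Fin m) (Fin m) ℂ}
    (h : ∀ i, X * spin m i = spin m i * X) : ∃ c : ℂ, X = c • 1 := by
  have hw : X * weight m = weight m * X := by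
    have := h 2
    simpa [spin_two, Complex.I_ne_zero] using this
  have hu : X * spinUp m = spinUp m * X := by
    have e : spinUp m = Complex.I • spin m 0 - spin m 1 := by
      rw [spin_zero, spin_one]
      match_scalars <;> grind [Complex.I_sq]
    rw [e, Matrix.mul_sub, Matrix.sub_mul, Matrix.mul_smul, Matrix.smul_mul, h, h]
  have hd : ∀ p q, p ≠ q → X p q = 0 := by
    intro p q hpq
    have := congrFun (congrFun hw p) q
    simp only [weight, mul_diagonal, diagonal_mul] at this
    have h0 : (((p : ℕ) : ℂ) - (q : ℕ)) * X p q = 0 := by linear_combination this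
    refine (mul_eq_zero.1 h0).resolve_left (sub_ne_zero.2 ?_)
    exact_mod_cast fun h => hpq (Fin.ext h)
  have hs : ∀ p q : Fin m, (q : ℕ) = p + 1 → X q q = X p p := by
    intro p q hpq
    have := congrFun (congrFun hu p) q
    simp only [mul_apply] at this
    rw [Finset.sum_eq_single p (fun b _ hb => by rw [hd p b hb.symm, zero_mul]) (by simp),
      Finset.sum_eq_single q (fun b _ hb => by rw [hd b q hb, mul_zero]) (by simp), mul_comm] at this
    exact (mul_left_cancel₀ (spinUp_apply_ne_zero p q hpq) this).symm
  rcases m with _ | m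
  · exact ⟨0, by ext p; exact p.elim0⟩
  refine ⟨X 0 0, ?_⟩
  have hall : ∀ (a : ℕ) (ha : a < m + 1), X ⟨a, ha⟩ ⟨a, ha⟩ = X 0 0 := by
    intro a
    induction a with
    | zero => intro _; rfl
    | succ a ih =>
      intro ha
      rw [← ih (by omega)]
      exact hs ⟨a, by omega⟩ ⟨a + 1, ha⟩ rfl
  ext p q
  by_cases hpq : p = q
  · subst hpq
    simpa using hall p p.2
  · simp [hpq, hd p q hpq]

/-- A vector operator `S` vanishes when its raising component `S₁ + i S₂` does. -/
theorem IsVectorOp.eq_zero_of_raising {ι κ : Type*} [Fintype ι] [Fintype κ]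
    {Y : Fin 3 → Matrix ι ι ℂ} {Z : Fin 3 → Matrix κ κ ℂ} {S : Fin 3 → Matrix ι κ ℂ}
    (h : IsVectorOp Y Z S) (h0 : S 0 + Complex.I • S 1 = 0) : S = 0 := by
  obtain ⟨⟨h1, h2, h3⟩, ⟨h4, h5, h6⟩, h7, h8, h9⟩ := isVectorOp_iff.1 h
  have e0 : S 0 = -(Complex.I • S 1) := eq_neg_of_add_eq_zero_left h0
  have e2 : S 2 = 0 := by
    rw [e0, Matrix.mul_neg, Matrix.neg_mul, Matrix.mul_smul, Matrix.smul_mul, h2, smul_add] at h1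
    have : Complex.I • S 2 = 0 := add_eq_left.1 (neg_injective h1)
    exact (smul_eq_zero.1 this).resolve_left Complex.I_ne_zero
  have e1 : S 1 = 0 := by simpa [e2] using h3
  funext i
  fin_cases i
  · simpa [e1] using e0
  · exact e1
  · exact e2

/-- A vector operator from spin `(m - 1) / 2` to spin `(m + 1) / 2` is determined by one entry:
its raising component preserves the index of the weight vectors, and it commutes with the raising
operator, so each of its diagonal entries determines the next. -/
theorem IsVectorOp.eq_zero_of_entry {m : ℕ} {S : Fin 3 → Matrix (Fin (m + 2)) (Fin m) ℂ}
    (h : IsVectorOp (spin (m + 2)) (spin m) S)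
    (h0 : ∀ hm : 0 < m, (S 0 + Complex.I • S 1) 0 ⟨0, hm⟩ = 0) : S = 0 := by
  apply h.eq_zero_of_raising
  obtain ⟨⟨h1, h2, h3⟩, ⟨h4, h5, h6⟩, h7, h8, h9⟩ := isVectorOp_iff.1 h
  -- The raising component increases the weight by one. As the highest weights differ by one, it
  -- maps the `q`-th weight vector to a multiple of the `q`-th weight vector.
  have hw : weight (m + 2) * (S 0 + Complex.I • S 1) =
      (S 0 + Complex.I • S 1) * weight m + (S 0 + Complex.I • S 1) := by
    have e : ∀ m, weight m = Complex.I • spin m 2 := fun m => by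
      rw [spin_two, smul_smul, mul_neg, Complex.I_mul_I, neg_neg, one_smul]
    rw [e, e]
    simp only [Matrix.mul_add, Matrix.add_mul, Matrix.smul_mul, Matrix.mul_smul, h7, h8]
    match_scalars <;> grind [Complex.I_sq]
  have hu : spinUp (m + 2) * (S 0 + Complex.I • S 1) =
      (S 0 + Complex.I • S 1) * spinUp m := by
    have e : ∀ m, spinUp m = Complex.I • spin m 0 - spin m 1 := fun m => by
      rw [spin_zero, spin_one]
      match_scalars <;> grind [Complex.I_sq]
    rw [e, e]
    simp only [Matrix.mul_add, Matrix.add_mul, Matrix.mul_sub, Matrix.sub_mul, Matrix.smul_mul,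
      Matrix.mul_smul, h1, h2, h4, h5]
    match_scalars <;> grind [Complex.I_sq]
  generalize S 0 + Complex.I • S 1 = X at *
  have hd : ∀ (p : Fin (m + 2)) (q : Fin m), (p : ℕ) ≠ q → X p q = 0 := by
    intro p q hpq
    have := congrFun (congrFun hw p) q
    simp only [weight, mul_diagonal, diagonal_mul, Matrix.add_apply] at this
    push_cast at this
    have h0 : (((q : ℕ) : ℂ) - (p : ℕ)) * X p q = 0 := by linear_combination this
    refine (mul_eq_zero.1 h0).resolve_left (sub_ne_zero.2 ?_)
    exact_mod_cast hpq.symm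
  have hall : ∀ (a : ℕ) (ha : a < m), X ⟨a, by omega⟩ ⟨a, ha⟩ = 0 := by
    intro a
    induction a with
    | zero => intro hm; exact h0 hm
    | succ a ih =>
      intro ha
      have := congrFun (congrFun hu ⟨a, by omega⟩) ⟨a + 1, ha⟩
      simp only [mul_apply] at this
      rw [Finset.sum_eq_single ⟨a + 1, by omega⟩, Finset.sum_eq_single ⟨a, by omega⟩,
        ih, zero_mul] at this
      · exact (mul_eq_zero.1 this).resolve_left (spinUp_apply_ne_zero _ _ rfl)
      · intro b _ hb
        rw [hd, zero_mul]
        exact fun h => hb (Fin.ext h.symm)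
      · simp
      · intro b _ hb
        rw [hd b, mul_zero]
        exact fun h => hb (Fin.ext h)
      · simp
  ext p q
  by_cases hpq : (p : ℕ) = q
  · have : p = ⟨q, by omega⟩ := Fin.ext hpq
    rw [this]
    exact hall q q.2
  · exact hd p q hpq

/-! ### Vector operators between irreducible representations -/

section

theorem RepEquiv.exists_matrix {ι κ : Type*} [Fintype ι] [Fintype κ] [DecidableEq ι]
    [DecidableEq κ] {Y : Fin 3 → Matrix ι ι ℂ} {Z : Fin 3 → Matrix κ κ ℂ} (h : RepEquiv Y Z) :
    ∃ (P : Matrix κ ι ℂ) (Q : Matrix ι κ ℂ), P * Q = 1 ∧ Q * P = 1 ∧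
      (∀ i, P * Y i = Z i * P) ∧ ∀ i, Y i * Q = Q * Z i := by
  obtain ⟨e, he⟩ := h
  have hPQ : LinearMap.toMatrix' (e : (ι → ℂ) →ₗ[ℂ] (κ → ℂ)) *
      LinearMap.toMatrix' (e.symm : (κ → ℂ) →ₗ[ℂ] (ι → ℂ)) = 1 := by
    rw [← LinearMap.toMatrix'_comp]; simp
  have hQP : LinearMap.toMatrix' (e.symm : (κ → ℂ) →ₗ[ℂ] (ι → ℂ)) *
      LinearMap.toMatrix' (e : (ι → ℂ) →ₗ[ℂ] (κ → ℂ)) = 1 := by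
    rw [← LinearMap.toMatrix'_comp]; simp
  have hP : ∀ i, LinearMap.toMatrix' (e : (ι → ℂ) →ₗ[ℂ] (κ → ℂ)) * Y i =
      Z i * LinearMap.toMatrix' (e : (ι → ℂ) →ₗ[ℂ] (κ → ℂ)) := by
    intro i
    apply Matrix.toLin'.injective
    refine LinearMap.ext fun v => ?_
    simp [Matrix.toLin'_mul, he]
  refine ⟨_, _, hPQ, hQP, hP, fun i => ?_⟩
  set P := LinearMap.toMatrix' (e : (ι → ℂ) →ₗ[ℂ] (κ → ℂ))
  set Q := LinearMap.toMatrix' (e.symm : (κ → ℂ) →ₗ[ℂ] (ι → ℂ))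
  calc Y i * Q = Q * P * Y i * Q := by rw [hQP, Matrix.one_mul]
    _ = Q * (P * Y i) * Q := by simp only [Matrix.mul_assoc]
    _ = Q * Z i * (P * Q) := by rw [hP]; simp only [Matrix.mul_assoc]
    _ = Q * Z i := by rw [hPQ, Matrix.mul_one]

variable {m : ℕ} {Y : Fin 3 → Matrix (Fin m) (Fin m) ℂ}

theorem IsIrrep.isVectorOp (h : IsIrrep m Y) : IsVectorOp Y Y Y := by
  obtain ⟨P, Q, hPQ, hQP, hP, hQ⟩ := h.2.exists_matrix
  have := (spin_isVectorOp m).mul_mul (P := Q) (Q := P) (fun i => (hQ i).symm)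
    (fun i => (hP i).symm)
  convert this using 2 with i
  rw [← hQ, Matrix.mul_assoc, hQP, Matrix.mul_one]

theorem IsIrrep.casimir (h : IsIrrep m Y) :
    dot Y Y = (-(((m : ℂ) ^ 2 - 1) / 4)) • (1 : Matrix (Fin m) (Fin m) ℂ) := by
  obtain ⟨P, Q, hPQ, hQP, hP, hQ⟩ := h.2.exists_matrix
  have e : P * dot Y Y = dot (spin m) (spin m) * P := by
    simp only [dot, Matrix.mul_sum, Matrix.sum_mul, ← Matrix.mul_assoc, hP]
    simp only [Matrix.mul_assoc, hP]
  rw [spin_casimir] at e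
  have := congrArg (Q * ·) e
  simpa [← Matrix.mul_assoc, hQP] using this

/-- Schur's lemma. -/
theorem IsIrrep.eq_smul_one (h : IsIrrep m Y) {X : Matrix (Fin m) (Fin m) ℂ}
    (hX : ∀ i, Y i * X = X * Y i) : ∃ c : ℂ, X = c • 1 := by
  obtain ⟨P, Q, hPQ, hQP, hP, hQ⟩ := h.2.exists_matrix
  obtain ⟨c, hc⟩ := eq_smul_one_of_comm_spin (X := P * X * Q) (fun i => by
    rw [Matrix.mul_assoc (P * X), ← hQ, ← Matrix.mul_assoc, Matrix.mul_assoc P, ← hX,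
      ← Matrix.mul_assoc, hP]
    simp only [Matrix.mul_assoc])
  refine ⟨c, ?_⟩
  have := congrArg (fun M => Q * M * P) hc
  simpa [← Matrix.mul_assoc, hQP, Matrix.mul_assoc X] using this

/-- The one-dimensional representation is trivial: each generator is a commutator of the others. -/
theorem IsIrrep.eq_zero_of_le_one (h : IsIrrep m Y) (hm : m ≤ 1) : Y = 0 := by
  have : Subsingleton (Fin m) := Fin.subsingleton_iff_le_one.2 hm
  have hc : ∀ A B : Matrix (Fin m) (Fin m) ℂ, A * B = B * A := by
    intro A B
    ext p q
    simp only [mul_apply, Subsingleton.elim q p]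
    exact Finset.sum_congr rfl fun r _ => by rw [Subsingleton.elim r p, mul_comm]
  obtain ⟨⟨h1, h2, h3⟩, ⟨h4, h5, h6⟩, h7, h8, h9⟩ := isVectorOp_iff.1 h.isVectorOp
  funext i
  fin_cases i
  · exact left_eq_add.1 ((hc _ _).trans h6)
  · exact left_eq_add.1 ((hc _ _).trans h7)
  · exact left_eq_add.1 ((hc _ _).trans h2)

theorem IsIrrep.ne_zero (h : IsIrrep m Y) (hm : 2 ≤ m) : Y ≠ 0 := by
  rintro rfl
  have := congrFun (congrFun h.casimir ⟨0, by omega⟩) ⟨0, by omega⟩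
  simp only [dot, Pi.zero_apply, Matrix.zero_mul, Finset.sum_const_zero, Matrix.zero_apply,
    Matrix.smul_apply, Matrix.one_apply_eq, smul_eq_mul, mul_one] at this
  have h1 : ((m : ℂ) ^ 2) = 1 := by linear_combination (-4) * (-this)
  have h2 : m ^ 2 = 1 := by exact_mod_cast h1
  nlinarith

/-- A vector operator of an irreducible representation is a multiple of the generators
(the projection theorem): after subtraction of a multiple of the generators its dot product with
them vanishes, and then `cross_cross` forces it to vanish. -/
theorem IsIrrep.exists_eq_smul (h : IsIrrep m Y) {S : Fin 3 → Matrix (Fin m) (Fin m) ℂ}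
    (hS : IsVectorOp Y Y S) : ∃ c : ℂ, S = c • Y := by
  by_cases hm : m ≤ 1
  · refine ⟨0, ?_⟩
    have hY := h.eq_zero_of_le_one hm
    obtain ⟨⟨h1, h2, h3⟩, ⟨h4, h5, h6⟩, h7, h8, h9⟩ := isVectorOp_iff.1 hS
    simp only [hY, Pi.zero_apply, Matrix.zero_mul, Matrix.mul_zero, zero_add] at h2 h6 h7
    rw [zero_smul]
    funext i
    fin_cases i
    exacts [h6.symm, h7.symm, h2.symm]
  have hc0 : -(((m : ℂ) ^ 2 - 1) / 4) ≠ 0 := by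
    intro h0
    have h1 : ((m : ℂ) ^ 2) = 1 := by linear_combination (-4) * h0
    have h2 : m ^ 2 = 1 := by exact_mod_cast h1
    nlinarith
  have hY := h.isVectorOp
  have hcas := h.casimir
  generalize -(((m : ℂ) ^ 2 - 1) / 4) = c at *
  obtain ⟨s, hs⟩ := h.eq_smul_one (fun i => hY.dot_comm hS i)
  refine ⟨s / c, ?_⟩
  rw [← sub_eq_zero]
  have hS' : IsVectorOp Y Y (S - (s / c) • Y) := hS.sub (hY.smul _)
  have hdot : dot Y (S - (s / c) • Y) = 0 := by
    have e : dot Y (S - (s / c) • Y) = dot Y S - (s / c) • dot Y Y := by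
      simp [dot, Matrix.mul_sub, Finset.smul_sum]
    rw [e, hs, hcas, smul_smul, div_mul_cancel₀ _ hc0, sub_self]
  generalize S - (s / c) • Y = S' at *
  have hcr : cross Y S' = S' := by
    funext i
    have := hS'.casimir_sub i
    rw [hcas, Matrix.smul_mul, Matrix.mul_smul, Matrix.one_mul, Matrix.mul_one, sub_self] at this
    exact (sub_eq_zero.1 ((smul_eq_zero.1 this.symm).resolve_left two_ne_zero)).symm
  funext i
  have := cross_cross (S := S') hY i
  rw [hcr, hcr, hdot, hcas, Matrix.mul_zero, zero_add, Matrix.smul_mul,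
    Matrix.one_mul] at this
  exact (smul_eq_zero.1 (sub_eq_self.1 this.symm)).resolve_left hc0

section TwoIrreps

variable {a b : ℕ} {Ya : Fin 3 → Matrix (Fin a) (Fin a) ℂ} {Yb : Fin 3 → Matrix (Fin b) (Fin b) ℂ}

/-- There is no intertwiner between different irreducible representations, because the values of
the Casimir operator differ. -/
theorem IsIrrep.intertwiner_eq_zero (ha : IsIrrep a Ya) (hb : IsIrrep b Yb) (hab : a ≠ b)
    {X : Matrix (Fin a) (Fin b) ℂ} (hX : ∀ i, Ya i * X = X * Yb i) : X = 0 := by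
  have e : dot Ya Ya * X = X * dot Yb Yb := by
    simp only [dot, Matrix.mul_sum, Matrix.sum_mul, Matrix.mul_assoc, hX]
    simp only [← Matrix.mul_assoc, hX]
  rw [ha.casimir, hb.casimir, Matrix.smul_mul, Matrix.mul_smul, Matrix.one_mul, Matrix.mul_one,
    ← sub_eq_zero, ← sub_smul] at e
  refine (smul_eq_zero.1 e).resolve_left fun h => hab ?_
  have h1 : ((a : ℂ) ^ 2) = (b : ℂ) ^ 2 := by linear_combination (-4) * h
  have h2 : a ^ 2 = b ^ 2 := by exact_mod_cast h1
  exact Nat.pow_left_injective (n := 2) two_ne_zero h2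

/-- The Casimir values determine the cross product of the generators with a vector operator. -/
theorem IsIrrep.cross_left (ha : IsIrrep a Ya) (hb : IsIrrep b Yb)
    {S : Fin 3 → Matrix (Fin a) (Fin b) ℂ} (hS : IsVectorOp Ya Yb S) :
    cross Ya S = (1 + ((a : ℂ) ^ 2 - (b : ℂ) ^ 2) / 8) • S := by
  funext i
  have := hS.casimir_sub i
  rw [ha.casimir, hb.casimir, Matrix.smul_mul, Matrix.mul_smul, Matrix.one_mul,
    Matrix.mul_one] at this
  have h2 : cross Ya S i = S i - (1 / 2 : ℂ) • ((2 : ℂ) • (S i - cross Ya S i)) := by module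
  rw [h2, ← this, Pi.smul_apply]
  module

/-- The selection rule for vector operators between irreducible representations. -/
theorem IsIrrep.vectorOp_eq_zero (ha : IsIrrep a Ya) (hb : IsIrrep b Yb) (ha0 : 1 ≤ a)
    (hb0 : 1 ≤ b) (hab : a ≠ b) (hab1 : a ≠ b + 2) (hab2 : b ≠ a + 2)
    {S : Fin 3 → Matrix (Fin a) (Fin b) ℂ} (hS : IsVectorOp Ya Yb S) : S = 0 := by
  have hdot : dot Ya S = 0 := ha.intertwiner_eq_zero hb hab (ha.isVectorOp.dot_comm hS)
  funext i
  have := cross_cross (S := S) ha.isVectorOp i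
  have hc := ha.cross_left hb hS
  have hcc : ∀ c : ℂ, cross Ya (c • S) = c • cross Ya S := fun c => by
    funext i; simp [cross, smul_sub]
  rw [hc, hcc, hc, hdot, ha.casimir, Matrix.mul_zero, zero_add, Matrix.smul_mul, Matrix.one_mul,
    Pi.smul_apply, Pi.smul_apply, smul_smul, ← sub_smul, ← sub_eq_zero, ← sub_smul] at this
  refine (smul_eq_zero.1 this).resolve_left fun h => ?_
  -- With `β` the eigenvalue in `Y × S = β S`, the equation `h` says `β² = β + (a² - 1) / 4`, and
  -- `β = 1 + (a² - b²) / 8`. The four linear factors give `a = b + 2`, `a = 2 - b`, `a = b - 2` and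
  -- `a = -b - 2`.
  have h' : ((a : ℂ) ^ 2 - (b : ℂ) ^ 2 + 4 - 4 * a) * ((a : ℂ) ^ 2 - (b : ℂ) ^ 2 + 4 + 4 * a)
      = 0 := by linear_combination 64 * h
  have h'' : ((a : ℤ) - 2 - b) * (a - 2 + b) * ((a + 2 - b) * (a + 2 + b)) = 0 := by
    have : (((a : ℂ) - 2 - b) * (a - 2 + b) * ((a + 2 - b) * (a + 2 + b))) = 0 := by
      linear_combination h'
    exact_mod_cast this
  rcases mul_eq_zero.1 h'' with h | h <;> rcases mul_eq_zero.1 h with h | h <;> omega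

end TwoIrreps

section Step

variable {Yp : Fin 3 → Matrix (Fin (m + 2)) (Fin (m + 2)) ℂ}
  {B : Fin 3 → Matrix (Fin (m + 2)) (Fin m) ℂ}

theorem IsInvariantTriple.ne_zero (hB : IsInvariantTriple m Yp Y B) : B ≠ 0 := by
  rintro rfl
  have := hB.2
  simp only [Pi.zero_apply, Matrix.zero_mul, trace_zero, Finset.sum_const_zero] at this
  exact absurd this.symm (by exact_mod_cast (by omega : m + 2 ≠ 0))

/-- A vector operator from `V_m` to `V_{m + 2}` is a multiple of the invariant triple. -/
theorem IsInvariantTriple.exists_eq_smul (hp : IsIrrep (m + 2) Yp) (h : IsIrrep m Y)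
    (hB : IsInvariantTriple m Yp Y B) {S : Fin 3 → Matrix (Fin (m + 2)) (Fin m) ℂ}
    (hS : IsVectorOp Yp Y S) : ∃ c : ℂ, S = c • B := by
  rcases Nat.eq_zero_or_pos m with rfl | hm
  · exact ⟨0, by funext i; ext p q; exact q.elim0⟩
  obtain ⟨P, Q, hPQ, hQP, hP, hQ⟩ := h.2.exists_matrix
  obtain ⟨P', Q', hPQ', hQP', hP', hQ'⟩ := hp.2.exists_matrix
  -- In the weight bases, a multiple of `B` is subtracted that makes the determining entry vanish.
  have key : ∀ X : Fin 3 → Matrix (Fin (m + 2)) (Fin m) ℂ, IsVectorOp Yp Y X →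
      (P' * X 0 * Q + Complex.I • (P' * X 1 * Q)) 0 ⟨0, hm⟩ = 0 → X = 0 := by
    intro X hX h0
    have := (hX.mul_mul hP' hQ).eq_zero_of_entry fun _ => h0
    funext i
    have := congrArg (fun M => Q' * M * P) (congrFun this i)
    simpa [← Matrix.mul_assoc, hQP', Matrix.mul_assoc (X i), hQP] using this
  have hb : (P' * B 0 * Q + Complex.I • (P' * B 1 * Q)) 0 ⟨0, hm⟩ ≠ 0 :=
    fun h0 => hB.ne_zero (key B hB.1 h0)
  refine ⟨(P' * S 0 * Q + Complex.I • (P' * S 1 * Q)) 0 ⟨0, hm⟩ /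
    (P' * B 0 * Q + Complex.I • (P' * B 1 * Q)) 0 ⟨0, hm⟩, ?_⟩
  rw [← sub_eq_zero]
  apply key _ (hS.sub (IsVectorOp.smul hB.1 _))
  have e : ∀ c : ℂ, P' * (S - c • B) 0 * Q + Complex.I • (P' * (S - c • B) 1 * Q) =
      (P' * S 0 * Q + Complex.I • (P' * S 1 * Q)) -
        c • (P' * B 0 * Q + Complex.I • (P' * B 1 * Q)) := fun c => by
    simp only [Pi.sub_apply, Pi.smul_apply, Matrix.mul_sub, Matrix.sub_mul, Matrix.mul_smul,
      Matrix.smul_mul]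
    module
  rw [e, Matrix.sub_apply, Matrix.smul_apply, smul_eq_mul, div_mul_cancel₀ _ hb, sub_self]

theorem IsInvariantTriple.cross_left (hp : IsIrrep (m + 2) Yp) (h : IsIrrep m Y)
    (hB : IsInvariantTriple m Yp Y B) : cross Yp B = (((m : ℂ) + 3) / 2) • B := by
  rw [hp.cross_left h hB.1]
  congr 1
  push_cast
  ring

theorem IsInvariantTriple.cross_right (hp : IsIrrep (m + 2) Yp) (h : IsIrrep m Y)
    (hB : IsInvariantTriple m Yp Y B) : cross B Y = (-(((m : ℂ) - 1) / 2)) • B := by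
  rw [IsVectorOp.cross_right hB.1, hB.cross_left hp h]
  module

theorem IsInvariantTriple.isVectorOp_conjTranspose (hp : IsIrrep (m + 2) Yp) (h : IsIrrep m Y)
    (hB : IsInvariantTriple m Yp Y B) : IsVectorOp Y Yp (fun i => (B i)ᴴ) :=
  IsVectorOp.conjTranspose hB.1 hp.1 h.1

theorem IsInvariantTriple.dot_conjTranspose (hp : IsIrrep (m + 2) Yp) (h : IsIrrep m Y)
    (hB : IsInvariantTriple m Yp Y B) : dot B (fun i => (B i)ᴴ) = 1 := by
  obtain ⟨c, hc⟩ := hp.eq_smul_one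
    (fun i => IsVectorOp.dot_comm hB.1 (hB.isVectorOp_conjTranspose hp h) i)
  have ht := hB.2
  rw [← trace_sum] at ht
  change (dot B (fun i => (B i)ᴴ)).trace = _ at ht
  rw [hc, trace_smul, trace_one, Fintype.card_fin, smul_eq_mul] at ht
  have hm : ((m : ℂ) + 2) ≠ 0 := by exact_mod_cast (by omega : m + 2 ≠ 0)
  have hc1 : c = 1 := mul_right_cancel₀ hm (by push_cast at ht; rw [ht, one_mul])
  rw [hc, hc1, one_smul]

/-- The scalar `B^* · B` has the same trace `m + 2` as `B · B^*`, on a space of dimension `m`. -/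
theorem IsInvariantTriple.conjTranspose_dot (hm : 1 ≤ m) (hp : IsIrrep (m + 2) Yp)
    (h : IsIrrep m Y) (hB : IsInvariantTriple m Yp Y B) :
    dot (fun i => (B i)ᴴ) B = (((m : ℂ) + 2) / m) • 1 := by
  obtain ⟨c, hc⟩ := h.eq_smul_one
    (fun i => IsVectorOp.dot_comm (hB.isVectorOp_conjTranspose hp h) hB.1 i)
  have ht := hB.2
  have : ∑ i, (B i * (B i)ᴴ).trace = (dot (fun i => (B i)ᴴ) B).trace := by
    rw [dot, trace_sum]
    exact Finset.sum_congr rfl fun i _ => trace_mul_comm _ _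
  rw [this, hc, trace_smul, trace_one, Fintype.card_fin, smul_eq_mul] at ht
  have hm : (m : ℂ) ≠ 0 := by exact_mod_cast (by omega : m ≠ 0)
  rw [hc, ← ht, mul_div_cancel_right₀ _ hm]

/-- The constant is found by taking the dot product with the generators:
`Y · (B × B^*) = (Y × B) · B^*`. -/
theorem IsInvariantTriple.cross_conjTranspose (hp : IsIrrep (m + 2) Yp) (h : IsIrrep m Y)
    (hB : IsInvariantTriple m Yp Y B) :
    cross B (fun i => (B i)ᴴ) = (-(2 / ((m : ℂ) + 1))) • Yp := by
  obtain ⟨c, hc⟩ := hp.exists_eq_smul (IsVectorOp.cross hB.1 (hB.isVectorOp_conjTranspose hp h))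
  have e := dot_cross Yp B (fun i => (B i)ᴴ)
  have e1 : dot Yp (c • Yp) = c • dot Yp Yp := by simp [dot, Finset.smul_sum]
  have e2 : ∀ r : ℂ, dot (r • B) (fun i => (B i)ᴴ) = r • dot B (fun i => (B i)ᴴ) := fun r => by
    simp [dot, Finset.smul_sum]
  rw [hc, hB.cross_left hp h, e1, e2, hB.dot_conjTranspose hp h, hp.casimir, smul_smul] at e
  have e3 := congrFun (congrFun e 0) 0
  simp only [Matrix.smul_apply, one_apply_eq, smul_eq_mul, mul_one] at e3
  push_cast at e3
  have hm3 : ((m : ℂ) + 3) ≠ 0 := by exact_mod_cast (by omega : m + 3 ≠ 0)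
  have hm1 : ((m : ℂ) + 1) ≠ 0 := by exact_mod_cast (by omega : m + 1 ≠ 0)
  rw [hc]
  congr 1
  have h2 : 2 / ((m : ℂ) + 1) * (m + 1) = 2 := div_mul_cancel₀ _ hm1
  apply mul_right_cancel₀ (mul_ne_zero hm1 hm3)
  linear_combination (-4) * e3 + ((m : ℂ) + 3) * h2

/-- The constant is found by taking the dot product with the generators:
`(B^* × B) · Y = B^* · (B × Y)`. For `m = 1` both sides vanish. -/
theorem IsInvariantTriple.conjTranspose_cross (hm : 1 ≤ m) (hp : IsIrrep (m + 2) Yp)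
    (h : IsIrrep m Y) (hB : IsInvariantTriple m Yp Y B) :
    cross (fun i => (B i)ᴴ) B = (2 * ((m : ℂ) + 2) / (m * (m + 1))) • Y := by
  -- For `m = 1` the Casimir value is zero, so the constant cannot be read off.
  rcases hm.eq_or_lt with rfl | hm2
  · obtain ⟨c, hc⟩ := h.exists_eq_smul (IsVectorOp.cross (hB.isVectorOp_conjTranspose hp h) hB.1)
    rw [hc, h.eq_zero_of_le_one le_rfl, smul_zero, smul_zero]
  obtain ⟨c, hc⟩ := h.exists_eq_smul (IsVectorOp.cross (hB.isVectorOp_conjTranspose hp h) hB.1)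
  have e := dot_cross (fun i => (B i)ᴴ) B Y
  have e1 : dot (c • Y) Y = c • dot Y Y := by simp [dot, Finset.smul_sum]
  have e2 : ∀ r : ℂ, dot (fun i => (B i)ᴴ) (r • B) = r • dot (fun i => (B i)ᴴ) B := fun r => by
    simp [dot, Finset.smul_sum]
  rw [hc, hB.cross_right hp h, e1, e2, hB.conjTranspose_dot hm hp h, h.casimir, smul_smul,
    smul_smul] at e
  have e3 := congrFun (congrFun e ⟨0, hm⟩) ⟨0, hm⟩
  simp only [Matrix.smul_apply, one_apply_eq, smul_eq_mul, mul_one] at e3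
  have hm0 : (m : ℂ) ≠ 0 := by exact_mod_cast (by omega : m ≠ 0)
  have hm1 : ((m : ℂ) + 1) ≠ 0 := by exact_mod_cast (by omega : m + 1 ≠ 0)
  have hm2' : ((m : ℂ) - 1) ≠ 0 := sub_ne_zero.2 (by exact_mod_cast (by omega : m ≠ 1))
  rw [hc]
  congr 1
  have h2 : ((m : ℂ) + 2) / m * m = m + 2 := div_mul_cancel₀ _ hm0
  have h3 : 2 * ((m : ℂ) + 2) / (m * (m + 1)) * (m * (m + 1)) = 2 * (m + 2) :=
    div_mul_cancel₀ _ (mul_ne_zero hm0 hm1)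
  apply mul_right_cancel₀ (mul_ne_zero (mul_ne_zero hm0 hm1) hm2')
  linear_combination (4 * (m : ℂ)) * e3 + (2 * ((m : ℂ) - 1)) * h2 - ((m : ℂ) - 1) * h3

end Step

end

/-! ### Analyticity of solutions of quadratic differential equations -/

section Analytic

variable {E : Type*} [NormedAddCommGroup E] [NormedSpace ℝ E]

/-- The Taylor coefficients at time `0` of the solution of `y' = Q(y, y)` with `y(0) = x`. -/
def quadCoeff (Q : E →L[ℝ] E →L[ℝ] E) (x : E) : ℕ → E
  | 0 => x
  | n + 1 => ((n : ℝ) + 1)⁻¹ • ∑ i : Fin (n + 1), Q (quadCoeff Q x i) (quadCoeff Q x (n - i))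
decreasing_by
  · exact i.2
  · omega

theorem quadCoeff_zero (Q : E →L[ℝ] E →L[ℝ] E) (x : E) : quadCoeff Q x 0 = x := by
  rw [quadCoeff]

theorem quadCoeff_succ (Q : E →L[ℝ] E →L[ℝ] E) (x : E) (n : ℕ) :
    quadCoeff Q x (n + 1) = ((n : ℝ) + 1)⁻¹ •
      ∑ i ∈ Finset.range (n + 1), Q (quadCoeff Q x i) (quadCoeff Q x (n - i)) := by
  rw [quadCoeff, Finset.sum_range]

theorem norm_quadCoeff_le (Q : E →L[ℝ] E →L[ℝ] E) {x : E} {K M : ℝ} (hK : ‖Q‖ ≤ K)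
    (hM : ‖x‖ ≤ M) (n : ℕ) : ‖quadCoeff Q x n‖ ≤ M * (K * M) ^ n := by
  have hK0 : 0 ≤ K := (norm_nonneg Q).trans hK
  have hM0 : 0 ≤ M := (norm_nonneg x).trans hM
  induction n using Nat.strong_induction_on with
  | _ n ih =>
    rcases n with _ | n
    · simpa [quadCoeff_zero] using hM
    · have hn : (0 : ℝ) < n + 1 := by positivity
      rw [quadCoeff_succ, norm_smul, norm_inv, Real.norm_of_nonneg hn.le, inv_mul_le_iff₀ hn]
      have h : ∀ i ∈ Finset.range (n + 1),
          ‖Q (quadCoeff Q x i) (quadCoeff Q x (n - i))‖ ≤ M * (K * M) ^ (n + 1) := by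
        intro i hi
        have hi' : i ≤ n := Nat.lt_succ_iff.1 (Finset.mem_range.1 hi)
        calc ‖Q (quadCoeff Q x i) (quadCoeff Q x (n - i))‖
            ≤ ‖Q‖ * ‖quadCoeff Q x i‖ * ‖quadCoeff Q x (n - i)‖ := Q.le_opNorm₂ _ _
          _ ≤ K * (M * (K * M) ^ i) * (M * (K * M) ^ (n - i)) := by
            gcongr
            · exact ih i (by omega)
            · exact ih (n - i) (by omega)
          _ = M * (K * M) * ((K * M) ^ i * (K * M) ^ (n - i)) := by ring
          _ = M * (K * M) ^ (n + 1) := by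
            rw [← pow_add, Nat.add_sub_cancel' hi', pow_succ]; ring
      refine (norm_sum_le_of_le _ h).trans_eq ?_
      simp

/-- Along a solution of `y' = Q(y, y)`, each Taylor coefficient is the normalised derivative of
the preceding one. -/
theorem hasDerivAt_quadCoeff (Q : E →L[ℝ] E →L[ℝ] E) {y : ℝ → E} {t : ℝ}
    (hy : HasDerivAt y (Q (y t) (y t)) t) (n : ℕ) :
    HasDerivAt (fun s => quadCoeff Q (y s) n) (((n : ℝ) + 1) • quadCoeff Q (y t) (n + 1)) t := by
  induction n using Nat.strong_induction_on with
  | _ n ih =>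
    rcases n with _ | n
    · simpa [quadCoeff_zero, quadCoeff_succ] using hy
    · have hn : ((n : ℝ) + 1) ≠ 0 := by positivity
      have hn2 : (((n + 1 : ℕ) : ℝ) + 1) ≠ 0 := by positivity
      simp only [quadCoeff_succ Q _ n]
      set c := quadCoeff Q (y t) with hc
      have h : ∀ i ∈ Finset.range (n + 1),
          HasDerivAt (fun s => Q (quadCoeff Q (y s) i) (quadCoeff Q (y s) (n - i)))
            (((i : ℝ) + 1) • Q (c (i + 1)) (c (n - i)) +
              ((n : ℝ) + 1 - i) • Q (c i) (c (n + 1 - i))) t := by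
        intro i hi
        have hi' : i ≤ n := Nat.lt_succ_iff.1 (Finset.mem_range.1 hi)
        have h1 := Q.hasFDerivAt.comp_hasDerivAt t (ih i (by omega))
        have h2 := h1.clm_apply (ih (n - i) (by omega))
        have e1 : n - i + 1 = n + 1 - i := by omega
        have e2 : ((n - i : ℕ) : ℝ) + 1 = n + 1 - i := by rw [Nat.cast_sub hi']; ring
        rw [e1, e2, map_smul] at h2
        refine h2.congr_deriv ?_
        rw [map_smul, _root_.smul_apply]
        rfl
      have hs := (HasDerivAt.fun_sum h).fun_const_smul (((n : ℝ) + 1)⁻¹)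
      refine hs.congr_deriv ?_
      -- The term `Q(c_j, c_{n+1-j})` occurs `j` times with the derivative on the first factor and
      -- `n + 1 - j` times with the derivative on the second.
      have e : ∑ j ∈ Finset.range (n + 1), (((j : ℝ) + 1) • Q (c (j + 1)) (c (n - j)) +
          ((n : ℝ) + 1 - j) • Q (c j) (c (n + 1 - j))) =
          ((n : ℝ) + 1) • ∑ j ∈ Finset.range (n + 2), Q (c j) (c (n + 1 - j)) := by
        have s1 := Finset.sum_range_succ' (fun j => (j : ℝ) • Q (c j) (c (n + 1 - j))) (n + 1)
        have s2 := Finset.sum_range_succ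
          (fun j => ((n : ℝ) + 1 - j) • Q (c j) (c (n + 1 - j))) (n + 1)
        simp only [Nat.cast_zero, zero_smul, add_zero, Nat.add_sub_add_right] at s1
        simp only [Nat.cast_add, Nat.cast_one, sub_self, zero_smul, add_zero] at s1 s2
        rw [Finset.sum_add_distrib, ← s1, ← s2, ← Finset.sum_add_distrib, Finset.smul_sum]
        refine Finset.sum_congr rfl fun j _ => ?_
        module
      rw [e, smul_smul, inv_mul_cancel₀ hn, one_smul, hc,
        quadCoeff_succ Q _ (n + 1), smul_smul, mul_inv_cancel₀ hn2, one_smul]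

/-- The derivative of a Taylor polynomial of a solution of `y' = Q(y, y)` in its base point. -/
theorem hasDerivAt_taylor (Q : E →L[ℝ] E →L[ℝ] E) {y : ℝ → E} {t : ℝ}
    (hy : HasDerivAt y (Q (y t) (y t)) t) (s : ℝ) (n : ℕ) :
    HasDerivAt (fun u => ∑ j ∈ Finset.range (n + 1), (s - u) ^ j • quadCoeff Q (y u) j)
      (((n : ℝ) + 1) • (s - t) ^ n • quadCoeff Q (y t) (n + 1)) t := by
  induction n with
  | zero => simpa [quadCoeff_zero, quadCoeff_succ] using hy
  | succ n ih =>
    simp only [Finset.sum_range_succ _ (n + 1)]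
    have h1 : HasDerivAt (fun u => (s - u) ^ (n + 1)) (-(((n : ℝ) + 1) * (s - t) ^ n)) t := by
      exact (((hasDerivAt_id t).const_sub s).pow (n + 1)).congr_deriv (by simp)
    refine (ih.fun_add (h1.fun_smul (hasDerivAt_quadCoeff Q hy (n + 1)))).congr_deriv ?_
    push_cast
    module

/-- Solutions of quadratic differential equations are real analytic. -/
theorem analyticAt_of_hasDerivAt_quadratic [CompleteSpace E] (Q : E →L[ℝ] E →L[ℝ] E) {y : ℝ → E}
    {t₀ : ℝ} (hy : ∀ᶠ t in nhds t₀, HasDerivAt y (Q (y t) (y t)) t) : AnalyticAt ℝ y t₀ := by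
  set M := ‖y t₀‖ + 1 with hM
  set K := ‖Q‖ + 1 with hK
  have hM0 : 0 < M := by positivity
  have hK0 : 0 < K := by positivity
  have hcont : ∀ᶠ t in nhds t₀, ‖y t‖ ≤ M :=
    (hy.self_of_nhds.continuousAt.norm.eventually_lt_const (lt_add_one _)).mono fun _ h => h.le
  obtain ⟨δ, hδ, hball⟩ := Metric.eventually_nhds_iff_ball.1 (hy.and hcont)
  -- This radius makes `2 r K M ≤ 1 / 2`; base point and argument of a Taylor polynomial are at most
  -- `2 r` apart in the ball of radius `r`.
  set r := min δ (1 / (4 * (K * M))) with hr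
  have hr0 : 0 < r := lt_min hδ (by positivity)
  have hq : 2 * r * (K * M) ≤ 1 / 2 := by
    have : r ≤ 1 / (4 * (K * M)) := min_le_right _ _
    rw [le_div_iff₀ (by positivity)] at this
    linarith
  have hrb : Metric.ball t₀ r ⊆ Metric.ball t₀ δ := Metric.ball_subset_ball (min_le_left _ _)
  have hbound : ∀ u ∈ Metric.ball t₀ r, ∀ n, ‖quadCoeff Q (y u) n‖ ≤ M * (K * M) ^ n :=
    fun u hu n => norm_quadCoeff_le Q (by simp [hK]) (hball u (hrb hu)).2 n
  have ht₀ : t₀ ∈ Metric.ball t₀ r := Metric.mem_ball_self hr0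
  have hdist : ∀ s ∈ Metric.ball t₀ r, ∀ u ∈ Metric.ball t₀ r, |s - u| ≤ 2 * r := by
    intro s hs u hu
    have h1 := abs_lt.1 (Metric.mem_ball.1 hs)
    have h2 := abs_lt.1 (Metric.mem_ball.1 hu)
    rw [abs_le]
    constructor <;> linarith [h1.1, h1.2, h2.1, h2.2]
  have hsum : ∀ s ∈ Metric.ball t₀ r,
      HasSum (fun n => (s - t₀) ^ n • quadCoeff Q (y t₀) n) (y s) := by
    intro s hs
    have hsm : Summable (fun n => (s - t₀) ^ n • quadCoeff Q (y t₀) n) := by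
      refine Summable.of_norm_bounded (g := fun n => M * (1 / 2 : ℝ) ^ n)
        (summable_geometric_two.mul_left M) fun n => ?_
      rw [norm_smul, norm_pow, Real.norm_eq_abs]
      calc |s - t₀| ^ n * ‖quadCoeff Q (y t₀) n‖ ≤ (2 * r) ^ n * (M * (K * M) ^ n) := by
            gcongr
            · exact hdist s hs t₀ ht₀
            · exact hbound t₀ ht₀ n
        _ = M * (2 * r * (K * M)) ^ n := by rw [mul_pow (2 * r)]; ring
        _ ≤ M * (1 / 2) ^ n := by gcongr
    rw [hsm.hasSum_iff_tendsto_nat, ← Filter.tendsto_add_atTop_iff_nat 1,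
      tendsto_iff_norm_sub_tendsto_zero]
    -- At the base point `s` the Taylor polynomial in the argument `s` is `y s`, so the remainder is
    -- bounded by moving the base point from `t₀` to `s`.
    have hle : ∀ n : ℕ, ‖∑ j ∈ Finset.range (n + 1), (s - t₀) ^ j • quadCoeff Q (y t₀) j - y s‖ ≤
        ((n : ℝ) + 1) * (1 / 2) ^ n * (M * (K * M)) * (2 * r) := by
      intro n
      have hmv := (convex_ball t₀ r).norm_image_sub_le_of_norm_hasDerivWithin_le
        (fun u hu => (hasDerivAt_taylor Q (hball u (hrb hu)).1 s n).hasDerivWithinAt)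
        (C := ((n : ℝ) + 1) * (1 / 2) ^ n * (M * (K * M))) (fun u hu => by
          rw [norm_smul, norm_smul, norm_pow, Real.norm_eq_abs, Real.norm_eq_abs,
            abs_of_nonneg (by positivity : (0 : ℝ) ≤ n + 1)]
          calc ((n : ℝ) + 1) * (|s - u| ^ n * ‖quadCoeff Q (y u) (n + 1)‖)
              ≤ ((n : ℝ) + 1) * ((2 * r) ^ n * (M * (K * M) ^ (n + 1))) := by
                gcongr
                · exact hdist s hs u hu
                · exact hbound u hu (n + 1)
            _ = ((n : ℝ) + 1) * (2 * r * (K * M)) ^ n * (M * (K * M)) := by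
                rw [mul_pow (2 * r), pow_succ]; ring
            _ ≤ ((n : ℝ) + 1) * (1 / 2) ^ n * (M * (K * M)) := by gcongr) hs ht₀
      have hself : ∑ j ∈ Finset.range (n + 1), (s - s) ^ j • quadCoeff Q (y s) j = y s := by
        simp [Finset.sum_range_succ', quadCoeff_zero]
      rw [hself] at hmv
      refine hmv.trans ?_
      rw [Real.norm_eq_abs]
      gcongr
      exact hdist t₀ ht₀ s hs
    refine squeeze_zero (fun n => norm_nonneg _) hle ?_
    have h1 := tendsto_self_mul_const_pow_of_lt_one (r := (1 / 2 : ℝ)) (by norm_num) (by norm_num)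
    have h2 := tendsto_pow_atTop_nhds_zero_of_lt_one (r := (1 / 2 : ℝ)) (by norm_num) (by norm_num)
    have h3 := ((h1.add h2).mul_const (M * (K * M))).mul_const (2 * r)
    simp only [add_zero, zero_mul] at h3
    refine h3.congr fun n => ?_
    ring
  let p : FormalMultilinearSeries ℝ ℝ E :=
    fun n => ContinuousMultilinearMap.mkPiRing ℝ (Fin n) (quadCoeff Q (y t₀) n)
  refine ⟨p, hasFPowerSeriesAt_iff'.2 ?_⟩
  filter_upwards [Metric.ball_mem_nhds t₀ hr0] with s hs
  simpa [p, FormalMultilinearSeries.coeff] using hsum s hs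

end Analytic

theorem eq_zero_right_of_hasDerivAt_mul {x p : ℝ → ℝ} {a b : ℝ} (hab : a ≤ b)
    (hp : ContinuousOn p (Set.Icc a b))
    (hx : ∀ t ∈ Set.Icc a b, HasDerivAt x (p t * x t) t) (ha : x a = 0) : x b = 0 := by
  obtain ⟨K, hK⟩ := isCompact_Icc.exists_bound_of_continuousOn hp
  refine eq_zero_of_abs_deriv_le_mul_abs_self_of_eq_zero_right (f := x) (K := K)
    (fun t ht => (hx t ht).continuousAt.continuousWithinAt)
    (fun t ht => (hx t (Set.Ico_subset_Icc_self ht)).hasDerivWithinAt) ha (fun t ht => ?_) b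
    (Set.right_mem_Icc.2 hab)
  rw [norm_mul]
  exact mul_le_mul_of_nonneg_right (hK t (Set.Ico_subset_Icc_self ht)) (norm_nonneg _)

/-- Uniqueness for scalar linear differential equations on an interval. -/
theorem eq_zero_of_hasDerivAt_mul {I : Set ℝ} (hI : IsPreconnected I) {x p : ℝ → ℝ}
    (hp : ContinuousOn p I) (hx : ∀ t ∈ I, HasDerivAt x (p t * x t) t) {t₀ : ℝ} (ht₀ : t₀ ∈ I)
    (h0 : x t₀ = 0) : ∀ t ∈ I, x t = 0 := by
  intro t ht
  rcases le_total t₀ t with h | h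
  · have hs := hI.Icc_subset ht₀ ht
    exact eq_zero_right_of_hasDerivAt_mul h (hp.mono hs) (fun u hu => hx u (hs hu)) h0
  · have hs : ∀ u ∈ Set.Icc (-t₀) (-t), -u ∈ I := fun u hu =>
      hI.Icc_subset ht ht₀ ⟨by linarith [hu.2], by linarith [hu.1]⟩
    have := eq_zero_right_of_hasDerivAt_mul (x := fun u => x (-u)) (p := fun u => -p (-u))
      (neg_le_neg h) ((hp.comp continuous_neg.continuousOn hs).neg) (fun u hu => by
        exact ((hx (-u) (hs u hu)).scomp u (hasDerivAt_neg u)).congr_deriv (by simp)) (by simpa using h0)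
    simpa using this

/-! ### Blocks of matrices on the direct sum -/

section Coord

variable {ι κ : Type*} [Fintype ι] [Fintype κ]

/-- The coefficient of `X` in the orthogonal projection of `S` to the line spanned by `X`, for the
Hilbert-Schmidt inner product. For `X = 0` it is zero, as a quotient by zero. -/
def coord (X : Fin 3 → Matrix ι κ ℂ) : (Fin 3 → Matrix ι κ ℂ) →ₗ[ℂ] ℂ where
  toFun S := (∑ i, ((X i)ᴴ * S i).trace) / ∑ i, ((X i)ᴴ * X i).trace
  map_add' S S' := by simp [Matrix.mul_add, Finset.sum_add_distrib, add_div]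
  map_smul' c S := by simp [← Finset.mul_sum, mul_div_assoc]

theorem coord_zero_left (S : Fin 3 → Matrix ι κ ℂ) : coord 0 S = 0 := by
  simp [coord]

open ComplexOrder in
theorem coord_smul_self {X : Fin 3 → Matrix ι κ ℂ} (hX : X ≠ 0) (c : ℂ) :
    coord X (c • X) = c := by
  have h : ∑ i, ((X i)ᴴ * X i).trace ≠ 0 := by
    intro h
    rw [Finset.sum_eq_zero_iff_of_nonneg
      fun i _ => (posSemidef_conjTranspose_mul_self (X i)).trace_nonneg] at h
    exact hX (funext fun i => trace_conjTranspose_mul_self_eq_zero_iff.1 (h i (Finset.mem_univ i)))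
  rw [map_smul, smul_eq_mul]
  change c * (_ / _) = c
  rw [div_self h, mul_one]

theorem eq_coord_smul {X S : Fin 3 → Matrix ι κ ℂ} (h : ∃ c : ℂ, S = c • X) :
    S = coord X S • X := by
  obtain ⟨c, rfl⟩ := h
  by_cases hX : X = 0
  · simp [hX]
  · rw [coord_smul_self hX]

end Coord

section Blocks

variable {n k : ℕ}

/-- The block in position `(a, b)` of a matrix on `V_{n+2k} ⊕ ⋯ ⊕ V_n`; it is zero when `a` or `b`
exceeds `k`. -/
def blk (a b : ℕ) :
    Matrix (Idx n k) (Idx n k) ℂ →ₗ[ℂ] Matrix (Fin (n + 2 * a)) (Fin (n + 2 * b)) ℂ where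
  toFun M := of fun p q =>
    if h : a < k + 1 ∧ b < k + 1 then M ⟨⟨a, h.1⟩, p⟩ ⟨⟨b, h.2⟩, q⟩ else 0
  map_add' M M' := by
    ext p q
    by_cases h : a < k + 1 ∧ b < k + 1
    · simp only [of_apply, dif_pos h, Matrix.add_apply]
    · simp only [of_apply, dif_neg h, Matrix.add_apply, add_zero]
  map_smul' c M := by
    ext p q
    by_cases h : a < k + 1 ∧ b < k + 1
    · simp only [of_apply, dif_pos h, Matrix.smul_apply, RingHom.id_apply]
    · simp only [of_apply, dif_neg h, Matrix.smul_apply, smul_zero]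

theorem blk_apply {a b : ℕ} (ha : a < k + 1) (hb : b < k + 1) (M : Matrix (Idx n k) (Idx n k) ℂ)
    (p : Fin (n + 2 * a)) (q : Fin (n + 2 * b)) :
    blk a b M p q = M ⟨⟨a, ha⟩, p⟩ ⟨⟨b, hb⟩, q⟩ :=
  dif_pos ⟨ha, hb⟩

theorem blk_apply_of_not {a b : ℕ} (h : ¬ (a < k + 1 ∧ b < k + 1))
    (M : Matrix (Idx n k) (Idx n k) ℂ) (p : Fin (n + 2 * a)) (q : Fin (n + 2 * b)) :
    blk a b M p q = 0 :=
  dif_neg h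

theorem blk_eq_zero_left {a b : ℕ} (ha : k < a) (M : Matrix (Idx n k) (Idx n k) ℂ) :
    blk a b M = 0 := by
  ext p q
  exact blk_apply_of_not (by omega) M p q

theorem blk_eq_zero_right {a b : ℕ} (hb : k < b) (M : Matrix (Idx n k) (Idx n k) ℂ) :
    blk a b M = 0 := by
  ext p q
  exact blk_apply_of_not (by omega) M p q

theorem blk_ext {M M' : Matrix (Idx n k) (Idx n k) ℂ}
    (h : ∀ a b, a ≤ k → b ≤ k → blk a b M = blk a b M') : M = M' := by
  ext ⟨⟨a, ha⟩, p⟩ ⟨⟨b, hb⟩, q⟩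
  rw [← blk_apply ha hb M p q, h a b (by omega) (by omega), blk_apply]

theorem blk_conjTranspose (a b : ℕ) (M : Matrix (Idx n k) (Idx n k) ℂ) :
    blk a b Mᴴ = (blk b a M)ᴴ := by
  ext p q
  by_cases h : a < k + 1 ∧ b < k + 1
  · rw [blk_apply h.1 h.2, conjTranspose_apply, conjTranspose_apply, blk_apply h.2 h.1]
  · have h' : ¬ (b < k + 1 ∧ a < k + 1) := fun h' => h h'.symm
    rw [blk_apply_of_not h, conjTranspose_apply, blk_apply_of_not h', star_zero]

theorem blk_mul (a c : ℕ) (M M' : Matrix (Idx n k) (Idx n k) ℂ) :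
    blk a c (M * M') = ∑ b ∈ Finset.range (k + 1), blk a b M * blk b c M' := by
  by_cases ha : a < k + 1
  · by_cases hc : c < k + 1
    · ext p q
      rw [blk_apply ha hc, mul_apply, Fintype.sum_sigma, Finset.sum_range, Matrix.sum_apply]
      refine Finset.sum_congr rfl fun b _ => ?_
      rw [mul_apply]
      refine Finset.sum_congr rfl fun r _ => ?_
      rw [blk_apply ha b.2, blk_apply b.2 hc]
    · rw [blk_eq_zero_right (by omega)]
      exact (Finset.sum_eq_zero fun b _ => by
        rw [blk_eq_zero_right (by omega) M', Matrix.mul_zero]).symm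
  · rw [blk_eq_zero_left (by omega)]
    exact (Finset.sum_eq_zero fun b _ => by
      rw [blk_eq_zero_left (by omega) M, Matrix.zero_mul]).symm

theorem blk_cross (a c : ℕ) (S S' : Fin 3 → Matrix (Idx n k) (Idx n k) ℂ) (i : Fin 3) :
    blk a c (cross S S' i) = ∑ b ∈ Finset.range (k + 1),
      cross (fun i => blk a b (S i)) (fun i => blk b c (S' i)) i := by
  simp only [cross, map_sub, blk_mul, Finset.sum_sub_distrib]

variable (Y : (m : ℕ) → Fin 3 → Matrix (Fin m) (Fin m) ℂ)
  (B : (m : ℕ) → Fin 3 → Matrix (Fin (m + 2)) (Fin m) ℂ)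

theorem blk_chainRep_self {a : ℕ} (ha : a ≤ k) (i : Fin 3) :
    blk a a (chainRep n k Y i) = Y (n + 2 * a) i := by
  ext p q
  rw [blk_apply (by omega) (by omega), chainRep, blockDiagonal'_apply_eq]

theorem blk_chainRep_ne {a b : ℕ} (hab : a ≠ b) (i : Fin 3) :
    blk a b (chainRep n k Y i) = 0 := by
  ext p q
  by_cases h : a < k + 1 ∧ b < k + 1
  · rw [blk_apply h.1 h.2, chainRep, blockDiagonal'_apply_ne]
    · rfl
    · simpa using hab
  · exact blk_apply_of_not h _ p q

theorem blk_chainRep_mul {a b : ℕ} (ha : a ≤ k) (i : Fin 3) (M : Matrix (Idx n k) (Idx n k) ℂ) :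
    blk a b (chainRep n k Y i * M) = Y (n + 2 * a) i * blk a b M := by
  rw [blk_mul, Finset.sum_eq_single a, blk_chainRep_self Y ha]
  · intro c _ hc
    rw [blk_chainRep_ne Y hc.symm, Matrix.zero_mul]
  · intro h
    exact absurd (Finset.mem_range.2 (by omega)) h

theorem blk_mul_chainRep {a b : ℕ} (hb : b ≤ k) (i : Fin 3) (M : Matrix (Idx n k) (Idx n k) ℂ) :
    blk a b (M * chainRep n k Y i) = blk a b M * Y (n + 2 * b) i := by
  rw [blk_mul, Finset.sum_eq_single b, blk_chainRep_self Y hb]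
  · intro c _ hc
    rw [blk_chainRep_ne Y hc, Matrix.mul_zero]
  · intro h
    exact absurd (Finset.mem_range.2 (by omega)) h

theorem blk_chainMatrix_self {a : ℕ} (ha : a ≤ k) (f g : ℕ → ℝ) (i : Fin 3) :
    blk a a (chainMatrix n k Y B f g i) = (f a : ℂ) • Y (n + 2 * a) i := by
  ext p q
  rw [blk_apply (by omega) (by omega)]
  simp [chainMatrix]

theorem blk_chainMatrix_succ_left {a : ℕ} (ha : a + 1 ≤ k) (f g : ℕ → ℝ) (i : Fin 3) :
    blk (a + 1) a (chainMatrix n k Y B f g i) = (g a : ℂ) • B (n + 2 * a) i := by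
  ext p q
  rw [blk_apply (by omega) (by omega)]
  simp [chainMatrix]

theorem blk_chainMatrix_succ_right {a : ℕ} (ha : a + 1 ≤ k) (f g : ℕ → ℝ) (i : Fin 3) :
    blk a (a + 1) (chainMatrix n k Y B f g i) = (-(g a : ℂ)) • (B (n + 2 * a) i)ᴴ := by
  ext p q
  rw [blk_apply (by omega) (by omega)]
  simp [chainMatrix, show ¬ a = a + 1 + 1 by omega]

theorem blk_chainMatrix_eq_zero {a b : ℕ} (h1 : a ≠ b) (h2 : a ≠ b + 1) (h3 : b ≠ a + 1)
    (f g : ℕ → ℝ) (i : Fin 3) : blk a b (chainMatrix n k Y B f g i) = 0 := by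
  ext p q
  by_cases h : a < k + 1 ∧ b < k + 1
  · rw [blk_apply h.1 h.2]
    simp [chainMatrix, h1.symm, h2, h3]
  · exact blk_apply_of_not h _ p q

end Blocks

/-! ### The cross product of a vector operator with itself, block by block -/

theorem cross_smul_smul {ι κ μ : Type*} [Fintype κ] (c d : ℂ) (S : Fin 3 → Matrix ι κ ℂ)
    (S' : Fin 3 → Matrix κ μ ℂ) : cross (c • S) (d • S') = (c * d) • cross S S' := by
  funext i
  simp [cross, smul_smul, smul_sub, mul_comm]

section Chain

variable {n k : ℕ}

/-- The coefficient of `Y_i^{n+2a}` in the diagonal block `a`. -/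
def diagCoeff (Y : (m : ℕ) → Fin 3 → Matrix (Fin m) (Fin m) ℂ) (a : ℕ) :
    (Fin 3 → Matrix (Idx n k) (Idx n k) ℂ) →ₗ[ℂ] ℂ :=
  coord (Y (n + 2 * a)) ∘ₗ (blk a a).compLeft (Fin 3)

/-- The coefficient of `B_i^{n+2a}` in the block `(a + 1, a)`. -/
def offCoeff (B : (m : ℕ) → Fin 3 → Matrix (Fin (m + 2)) (Fin m) ℂ) (a : ℕ) :
    (Fin 3 → Matrix (Idx n k) (Idx n k) ℂ) →ₗ[ℂ] ℂ :=
  coord (B (n + 2 * a)) ∘ₗ (blk (a + 1) a).compLeft (Fin 3)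

variable {Y : (m : ℕ) → Fin 3 → Matrix (Fin m) (Fin m) ℂ}
  {B : (m : ℕ) → Fin 3 → Matrix (Fin (m + 2)) (Fin m) ℂ}
  {S : Fin 3 → Matrix (Idx n k) (Idx n k) ℂ}

theorem diagCoeff_eq {a : ℕ} (hY : Y (n + 2 * a) ≠ 0) {c : ℂ}
    (h : (fun i => blk a a (S i)) = c • Y (n + 2 * a)) : diagCoeff Y a S = c := by
  have : diagCoeff Y a S = coord (Y (n + 2 * a)) (fun i => blk a a (S i)) := rfl
  rw [this, h, coord_smul_self hY]

theorem offCoeff_eq {a : ℕ} (hB : B (n + 2 * a) ≠ 0) {c : ℂ}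
    (h : (fun i => blk (a + 1) a (S i)) = c • B (n + 2 * a)) : offCoeff B a S = c := by
  have : offCoeff B a S = coord (B (n + 2 * a)) (fun i => blk (a + 1) a (S i)) := rfl
  rw [this, h, coord_smul_self hB]

theorem offCoeff_eq_zero {a : ℕ} (ha : k ≤ a) : offCoeff B a S = 0 := by
  have : offCoeff B a S = coord (B (n + 2 * a)) (fun i => blk (a + 1) a (S i)) := rfl
  rw [this, show (fun i => blk (a + 1) a (S i)) = 0 from
    funext fun i => blk_eq_zero_left (by omega) _, map_zero]

theorem IsVectorOp.blk (hS : IsVectorOp (chainRep n k Y) (chainRep n k Y) S) {a b : ℕ}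
    (ha : a ≤ k) (hb : b ≤ k) :
    IsVectorOp (Y (n + 2 * a)) (Y (n + 2 * b)) (fun i => blk a b (S i)) := by
  intro i j
  have := congrArg (NahmChain.blk a b) (hS i j)
  simpa only [map_sub, map_sum, map_smul, blk_chainRep_mul Y ha, blk_mul_chainRep Y hb] using this

variable (hn : 1 ≤ n) (hY : ∀ m, 1 ≤ m → IsIrrep m (Y m))
  (hB : ∀ m, 1 ≤ m → IsInvariantTriple m (Y (m + 2)) (Y m) (B m))
  (hS : IsVectorOp (chainRep n k Y) (chainRep n k Y) S) (hskew : ∀ i, (S i)ᴴ = -S i)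

include hn hY hS in
theorem blk_self_eq {a : ℕ} (ha : a ≤ k) :
    (fun i => blk a a (S i)) = diagCoeff Y a S • Y (n + 2 * a) :=
  eq_coord_smul ((hY _ (by omega)).exists_eq_smul (hS.blk ha ha))

include hn hY hS hskew in
/-- The diagonal coefficients are real; where the generators are zero, so is the coefficient. -/
theorem star_diagCoeff {a : ℕ} (ha : a ≤ k) : star (diagCoeff Y a S) = diagCoeff Y a S := by
  by_cases h0 : Y (n + 2 * a) = 0
  · have : diagCoeff Y a S = coord (Y (n + 2 * a)) (fun i => blk a a (S i)) := rfl
    rw [this, h0, coord_zero_left, star_zero]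
  · refine (diagCoeff_eq h0 ?_).symm
    have h := blk_self_eq hn hY hS ha
    funext i
    have h1 : (blk a a (S i))ᴴ = -blk a a (S i) := by rw [← blk_conjTranspose, hskew, map_neg]
    have h2 := congrFun h i
    simp only [Pi.smul_apply] at h2 ⊢
    rw [← neg_neg (blk a a (S i)), ← h1, h2, conjTranspose_smul, (hY _ (by omega)).1, smul_neg,
      neg_neg]

include hn hY hB hS in
theorem blk_succ_left_eq (a : ℕ) :
    (fun i => blk (a + 1) a (S i)) = offCoeff B a S • B (n + 2 * a) := by
  by_cases ha : a + 1 ≤ k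
  · exact eq_coord_smul ((hB (n + 2 * a) (by omega)).exists_eq_smul (hY _ (by omega))
      (hY _ (by omega)) (hS.blk ha (by omega)))
  · rw [offCoeff_eq_zero (by omega), zero_smul]
    exact funext fun i => blk_eq_zero_left (by omega) _

include hn hY hB hS hskew in
theorem blk_succ_right_eq (a : ℕ) :
    (fun i => blk a (a + 1) (S i)) =
      (-star (offCoeff B a S)) • fun i => (B (n + 2 * a) i)ᴴ := by
  funext i
  have h := congrFun (blk_succ_left_eq hn hY hB hS a) i
  simp only [Pi.smul_apply] at h ⊢
  rw [← neg_neg (S i), ← hskew, map_neg, blk_conjTranspose, h, conjTranspose_smul, neg_smul]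

include hn hY hS in
theorem blk_eq_zero {a b : ℕ} (h1 : a ≠ b) (h2 : a ≠ b + 1) (h3 : b ≠ a + 1) (i : Fin 3) :
    blk a b (S i) = 0 := by
  by_cases ha : a ≤ k
  · by_cases hb : b ≤ k
    · exact congrFun ((hY _ (by omega)).vectorOp_eq_zero (hY _ (by omega)) (by omega) (by omega)
        (by omega) (by omega) (by omega) (hS.blk ha hb)) i
    · exact blk_eq_zero_right (by omega) _
  · exact blk_eq_zero_left (by omega) _

include hn hY hB hS hskew in
/-- A skew-Hermitian vector operator on `V_{n+2k} ⊕ ⋯ ⊕ V_n` whose coefficients next to the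
diagonal are real is one of the block tridiagonal matrices `chainMatrix`. -/
theorem eq_chainMatrix (f g : ℕ → ℝ) (hf : ∀ a ≤ k, (f a : ℂ) = diagCoeff Y a S)
    (hg : ∀ a, a + 1 ≤ k → (g a : ℂ) = offCoeff B a S) (i : Fin 3) :
    S i = chainMatrix n k Y B f g i := by
  refine blk_ext fun a b ha hb => ?_
  by_cases h1 : a = b
  · subst h1
    rw [blk_chainMatrix_self Y B ha, hf a ha]
    exact congrFun (blk_self_eq hn hY hS ha) i
  by_cases h2 : a = b + 1
  · subst h2
    rw [blk_chainMatrix_succ_left Y B ha, hg b ha]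
    exact congrFun (blk_succ_left_eq hn hY hB hS b) i
  by_cases h3 : b = a + 1
  · subst h3
    rw [blk_chainMatrix_succ_right Y B hb, ← Complex.conj_ofReal, hg a hb]
    exact congrFun (blk_succ_right_eq hn hY hB hS hskew a) i
  · rw [blk_chainMatrix_eq_zero Y B h1 h2 h3, blk_eq_zero hn hY hS h1 h2 h3]

theorem sum_range_eq_sum {V : Type*} [AddCommMonoid V] (F : ℕ → V) (s : Finset ℕ)
    (h1 : ∀ b ∉ s, F b = 0) (h2 : ∀ b, k < b → F b = 0) :
    ∑ b ∈ Finset.range (k + 1), F b = ∑ b ∈ s, F b := by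
  rw [Finset.sum_subset (Finset.subset_union_left (s₂ := s)) (fun b _ hb => h2 b (by
      simpa [Nat.lt_succ_iff] using hb)),
    Finset.sum_subset (Finset.subset_union_right (s₁ := Finset.range (k + 1)))
      (fun b _ hb => h1 b hb)]

theorem cross_blk_eq_zero_of_lt {a b c : ℕ} (hb : k < b) (i : Fin 3) :
    cross (fun i => blk a b (S i)) (fun i => blk b c (S i)) i = 0 := by
  simp [cross, blk_eq_zero_left hb]

include hn hY hS in
theorem cross_blk_self {a : ℕ} (ha : a ≤ k) :
    cross (fun i => blk a a (S i)) (fun i => blk a a (S i)) =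
      (diagCoeff Y a S ^ 2) • Y (n + 2 * a) := by
  rw [blk_self_eq hn hY hS ha, cross_smul_smul, ← sq]
  congr 1
  have := IsVectorOp.cross_right (hY (n + 2 * a) (by omega)).isVectorOp
  have h2 : (2 : ℂ) • cross (Y (n + 2 * a)) (Y (n + 2 * a)) = (2 : ℂ) • Y (n + 2 * a) := by
    rw [two_smul]
    nth_rw 1 [this]
    abel
  exact smul_right_injective _ two_ne_zero h2

include hn hY hB hS hskew in
theorem cross_blk_succ (a : ℕ) :
    cross (fun i => blk a (a + 1) (S i)) (fun i => blk (a + 1) a (S i)) =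
      (-(2 * (((n + 2 * a : ℕ) : ℂ) + 2) / ((n + 2 * a : ℕ) * ((n + 2 * a : ℕ) + 1)) *
        (star (offCoeff B a S) * offCoeff B a S))) • Y (n + 2 * a) := by
  rw [blk_succ_left_eq hn hY hB hS, blk_succ_right_eq hn hY hB hS hskew]
  refine (cross_smul_smul _ _ _ _).trans ?_
  rw [(hB (n + 2 * a) (by omega)).conjTranspose_cross (by omega) (hY _ (by omega))
    (hY _ (by omega)), smul_smul]
  congr 1
  ring

include hn hY hB hS hskew in
theorem cross_blk_pred (a : ℕ) :
    cross (fun i => blk (a + 1) a (S i)) (fun i => blk a (a + 1) (S i)) =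
      (2 / (((n + 2 * a : ℕ) : ℂ) + 1) *
        (star (offCoeff B a S) * offCoeff B a S)) • Y (n + 2 * (a + 1)) := by
  rw [blk_succ_left_eq hn hY hB hS, blk_succ_right_eq hn hY hB hS hskew]
  refine (cross_smul_smul _ _ _ _).trans ?_
  rw [(hB (n + 2 * a) (by omega)).cross_conjTranspose (hY _ (by omega))
    (hY _ (by omega)), smul_smul]
  change _ = _ • Y (n + 2 * a + 2)
  congr 1
  ring

include hn hY hB hS hskew in
theorem blk_cross_zero : (fun i => blk 0 0 (cross S S i)) =
    (diagCoeff Y 0 S ^ 2 - 2 * ((n : ℂ) + 2) / (n * (n + 1)) *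
      (star (offCoeff B 0 S) * offCoeff B 0 S)) • Y (n + 2 * 0) := by
  have h0 := cross_blk_self hn hY hS (Nat.zero_le k)
  have h1 := cross_blk_succ hn hY hB hS hskew 0
  funext i
  rw [blk_cross, sum_range_eq_sum _ {0, 1} _ fun b hb => cross_blk_eq_zero_of_lt hb i]
  · rw [Finset.sum_pair zero_ne_one, h0]
    have h1' := congrFun h1 i
    rw [zero_add] at h1'
    rw [h1']
    simp only [Pi.smul_apply, ← add_smul]
    congr 1
  · intro b hb
    simp only [Finset.mem_insert, Finset.mem_singleton, not_or] at hb
    simp [cross, blk_eq_zero hn hY hS (show 0 ≠ b by omega) (by omega) (by omega)]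

include hn hY hB hS hskew in
theorem blk_cross_succ {a : ℕ} (ha : a + 1 ≤ k) :
    (fun i => blk (a + 1) (a + 1) (cross S S i)) =
    (diagCoeff Y (a + 1) S ^ 2 +
      2 / ((n : ℂ) + 2 * (a + 1) - 1) * (star (offCoeff B a S) * offCoeff B a S) -
      2 * ((n : ℂ) + 2 * (a + 1) + 2) / ((n + 2 * (a + 1)) * (n + 2 * (a + 1) + 1)) *
      (star (offCoeff B (a + 1) S) * offCoeff B (a + 1) S)) • Y (n + 2 * (a + 1)) := by
  have h0 := cross_blk_self hn hY hS ha
  have h1 := cross_blk_succ hn hY hB hS hskew (a + 1)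
  have h2 := cross_blk_pred hn hY hB hS hskew a
  funext i
  rw [blk_cross, sum_range_eq_sum _ {a, a + 1, a + 2} _ fun b hb => cross_blk_eq_zero_of_lt hb i]
  · rw [Finset.sum_insert (by simp), Finset.sum_pair (by simp), h0, h1, h2]
    simp only [Pi.smul_apply, ← add_smul]
    congr 1
    push_cast
    rw [show (n : ℂ) + 2 * (a + 1) - 1 = n + 2 * a + 1 by ring]
    ring
  · intro b hb
    simp only [Finset.mem_insert, Finset.mem_singleton, not_or] at hb
    simp [cross, blk_eq_zero hn hY hS (show a + 1 ≠ b by omega) (by omega) (by omega)]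

include hn hY hB hS in
theorem blk_cross_off {a : ℕ} (ha : a + 1 ≤ k) :
    (fun i => blk (a + 1) a (cross S S i)) =
    ((((n : ℂ) + 2 * a + 3) / 2 * diagCoeff Y (a + 1) S -
      ((n : ℂ) + 2 * a - 1) / 2 * diagCoeff Y a S) * offCoeff B a S) • B (n + 2 * a) := by
  have hp := hY (n + 2 * a + 2) (by omega)
  have hm := hY (n + 2 * a) (by omega)
  have hb := hB (n + 2 * a) (by omega)
  have h0 : cross (fun i => blk (a + 1) a (S i)) (fun i => blk a a (S i)) =
      (-(((n : ℂ) + 2 * a - 1) / 2 * diagCoeff Y a S * offCoeff B a S)) • B (n + 2 * a) := by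
    rw [blk_self_eq hn hY hS (by omega), blk_succ_left_eq hn hY hB hS]
    refine (cross_smul_smul _ _ _ _).trans ?_
    rw [hb.cross_right hp hm, smul_smul]
    congr 1
    push_cast
    ring
  have h1 : cross (fun i => blk (a + 1) (a + 1) (S i)) (fun i => blk (a + 1) a (S i)) =
      (((n : ℂ) + 2 * a + 3) / 2 * diagCoeff Y (a + 1) S * offCoeff B a S) • B (n + 2 * a) := by
    rw [blk_self_eq hn hY hS ha, blk_succ_left_eq hn hY hB hS]
    refine (cross_smul_smul _ _ _ _).trans ?_
    refine (congrArg _ (hb.cross_left hp hm)).trans ?_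
    rw [smul_smul]
    congr 1
    push_cast
    ring
  funext i
  rw [blk_cross, sum_range_eq_sum _ {a, a + 1} _ fun b hb => cross_blk_eq_zero_of_lt hb i]
  · rw [Finset.sum_pair (by simp), h0, h1]
    simp only [Pi.smul_apply]
    rw [← add_smul]
    congr 1
    ring
  · intro b hb
    simp only [Finset.mem_insert, Finset.mem_singleton, not_or] at hb
    -- For `b = a + 2` the second factor vanishes, in all other cases the first.
    by_cases h : b = a + 2
    · subst h
      simp [cross, blk_eq_zero hn hY hS (show a + 2 ≠ a by omega) (by omega) (by omega)]
    · simp [cross, blk_eq_zero hn hY hS (show a + 1 ≠ b by omega) (by omega) (by omega)]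

end Chain

/-! ### The unitary gauge -/

section Gauge

variable {n k N : ℕ}

/-- The diagonal matrix that acts on the summand `V_{n+2a}` as the scalar `d a`. -/
def blockScalar (n k : ℕ) (d : ℕ → ℂ) : Matrix (Idx n k) (Idx n k) ℂ :=
  diagonal fun x => d x.1

theorem blk_blockScalar_mul_mul (c d : ℕ → ℂ) (M : Matrix (Idx n k) (Idx n k) ℂ) (a b : ℕ) :
    blk a b (blockScalar n k c * M * blockScalar n k d) = (c a * d b) • blk a b M := by
  ext p q
  by_cases h : a < k + 1 ∧ b < k + 1
  · rw [Matrix.smul_apply, blk_apply h.1 h.2, blk_apply h.1 h.2, blockScalar, blockScalar,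
      mul_diagonal, diagonal_mul, smul_eq_mul]
    ring
  · rw [Matrix.smul_apply, blk_apply_of_not h, blk_apply_of_not h, smul_zero]

theorem blockScalar_mul (c d : ℕ → ℂ) :
    blockScalar n k c * blockScalar n k d =
      blockScalar n k fun a => c a * d a := by
  simp [blockScalar]

theorem blockScalar_conjTranspose (d : ℕ → ℂ) :
    (blockScalar n k d)ᴴ = blockScalar n k fun a => star (d a) := by
  rw [blockScalar, diagonal_conjTranspose]
  rfl

theorem blockScalar_one : (blockScalar n k fun _ => 1) = 1 :=
  diagonal_one

theorem chainRep_mul_blockScalar (Y : (m : ℕ) → Fin 3 → Matrix (Fin m) (Fin m) ℂ) (d : ℕ → ℂ)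
    (i : Fin 3) : chainRep n k Y i * blockScalar n k d = blockScalar n k d * chainRep n k Y i := by
  have h1 := fun a b => blk_blockScalar_mul_mul (fun _ => 1) d (chainRep n k Y i) a b
  have h2 := fun a b => blk_blockScalar_mul_mul d (fun _ => 1) (chainRep n k Y i) a b
  simp only [blockScalar_one, one_mul, mul_one] at h1 h2
  refine blk_ext fun a b _ _ => ?_
  rw [h1, h2]
  by_cases hab : a = b
  · rw [hab]
  · rw [blk_chainRep_ne Y hab, smul_zero, smul_zero]

variable {Y : (m : ℕ) → Fin 3 → Matrix (Fin m) (Fin m) ℂ}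

/-- Schur's lemma for the multiplicity free representation `V_{n+2k} ⊕ ⋯ ⊕ V_n`. -/
theorem exists_eq_blockScalar (hn : 1 ≤ n) (hY : ∀ m, 1 ≤ m → IsIrrep m (Y m))
    {G : Matrix (Idx n k) (Idx n k) ℂ} (hG : ∀ i, chainRep n k Y i * G = G * chainRep n k Y i) :
    ∃ d : ℕ → ℂ, G = blockScalar n k d := by
  have hb : ∀ a b, a ≤ k → b ≤ k → ∀ i,
      Y (n + 2 * a) i * blk a b G = blk a b G * Y (n + 2 * b) i := fun a b ha hb i => by
    rw [← blk_chainRep_mul Y ha, hG, blk_mul_chainRep Y hb]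
  have hd : ∀ a, ∃ c : ℂ, a ≤ k → blk a a G = c • 1 := by
    intro a
    by_cases ha : a ≤ k
    · obtain ⟨c, hc⟩ := (hY (n + 2 * a) (by omega)).eq_smul_one (hb a a ha ha)
      exact ⟨c, fun _ => hc⟩
    · exact ⟨0, fun h => absurd h ha⟩
  choose d hd using hd
  refine ⟨d, blk_ext fun a b ha hb' => ?_⟩
  have h := blk_blockScalar_mul_mul (fun _ => 1) d (1 : Matrix (Idx n k) (Idx n k) ℂ) a b
  simp only [blockScalar_one, one_mul] at h
  rw [h]
  by_cases hab : a = b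
  · subst hab
    rw [hd a ha]
    congr 1
    ext p q
    rw [blk_apply (by omega) (by omega), one_apply, one_apply]
    simp
  · rw [(hY (n + 2 * a) (by omega)).intertwiner_eq_zero (hY (n + 2 * b) (by omega)) (by omega)
      (hb a b ha hb')]
    ext p q
    rw [Matrix.smul_apply, blk_apply (by omega) (by omega), one_apply_ne, smul_zero]
    · rfl
    · intro h
      exact hab (congrArg (fun x => ((Sigma.fst x : Fin (k + 1)) : ℕ)) h)

theorem chainRep_conjTranspose (hn : 1 ≤ n) (hY : ∀ m, 1 ≤ m → IsIrrep m (Y m)) (i : Fin 3) :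
    (chainRep n k Y i)ᴴ = -chainRep n k Y i := by
  rw [chainRep, blockDiagonal'_conjTranspose, ← blockDiagonal'_neg]
  congr 1
  funext a
  exact (hY _ (by omega)).1 i

open ComplexOrder in
/-- An isomorphism from `V_{n+2k} ⊕ ⋯ ⊕ V_n` to a skew-Hermitian representation can be made
unitary by rescaling it on each summand. -/
theorem exists_unitary_intertwiner (hn : 1 ≤ n) (hY : ∀ m, 1 ≤ m → IsIrrep m (Y m))
    (e : Fin N ≃ Idx n k) {R : Fin 3 → Matrix (Fin N) (Fin N) ℂ} (hR : ∀ i, (R i)ᴴ = -R i)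
    (h : RepEquiv R (chainRep n k Y)) :
    ∃ V : Matrix (Fin N) (Idx n k) ℂ, Vᴴ * V = 1 ∧ V * Vᴴ = 1 ∧
      ∀ i, R i * V = V * chainRep n k Y i := by
  obtain ⟨P, Q, hPQ, hQP, hP, hQ⟩ := h.exists_matrix
  have hG : ∀ i, chainRep n k Y i * (Qᴴ * Q) = (Qᴴ * Q) * chainRep n k Y i := by
    intro i
    have h1 := congrArg conjTranspose (hQ i)
    rw [conjTranspose_mul, conjTranspose_mul, hR, chainRep_conjTranspose hn hY, Matrix.mul_neg,
      Matrix.neg_mul, neg_inj] at h1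
    rw [← Matrix.mul_assoc, ← h1, Matrix.mul_assoc, hQ, Matrix.mul_assoc]
  obtain ⟨d, hd⟩ := exists_eq_blockScalar hn hY hG
  have hpos : ∀ a, a < k + 1 → 0 < d a := by
    intro a ha
    have hinj : Function.Injective Q.mulVec := by
      intro x y hxy
      have := congrArg P.mulVec hxy
      simpa [mulVec_mulVec, hPQ] using this
    have := (PosDef.conjTranspose_mul_self Q hinj).diag_pos (i := ⟨⟨a, ha⟩, ⟨0, by omega⟩⟩)
    rw [hd] at this
    simpa [blockScalar] using this
  -- The Gram matrix of `Q` is the scalar `d a > 0` on `V_{n+2a}`, so dividing by `√(d a)` there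
  -- makes `Q` unitary.
  set c : ℕ → ℂ := fun a => (((√(d a).re)⁻¹ : ℝ) : ℂ) with hc
  have hstar : ∀ a, star (c a) = c a := fun a => Complex.conj_ofReal _
  have hV : (Q * blockScalar n k c)ᴴ * (Q * blockScalar n k c) = 1 := by
    rw [conjTranspose_mul, blockScalar_conjTranspose, Matrix.mul_assoc, ← Matrix.mul_assoc Qᴴ, hd,
      blockScalar_mul, blockScalar_mul, ← blockScalar_one, blockScalar, blockScalar]
    congr 1
    funext x
    have hx := hpos x.1 x.1.2
    have hre : 0 < (d x.1).re := (Complex.pos_iff.1 hx).1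
    have him : ((d x.1).re : ℂ) = d x.1 := by
      apply Complex.ext
      · simp
      · simpa using (Complex.pos_iff.1 hx).2
    rw [hstar, hc]
    simp only
    rw [← him]
    norm_cast
    have hs := Real.sq_sqrt hre.le
    have hs0 : √(d x.1).re ≠ 0 := (Real.sqrt_pos.2 hre).ne'
    field_simp
    exact hs.symm
  refine ⟨Q * blockScalar n k c, hV, ?_, fun i => ?_⟩
  · exact (mul_eq_one_comm_of_equiv e.symm).1 hV
  · rw [← Matrix.mul_assoc, hQ, Matrix.mul_assoc, chainRep_mul_blockScalar, Matrix.mul_assoc]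

theorem exists_phase (z : ℂ) : ∃ u : ℂ, star u * u = 1 ∧ (star u * z).im = 0 := by
  by_cases hz : z = 0
  · exact ⟨1, by simp, by simp [hz]⟩
  · have hz' : (‖z‖ : ℂ) ≠ 0 := by simpa using hz
    have h : starRingEnd ℂ z * z = (‖z‖ : ℂ) ^ 2 := Complex.conj_mul' z
    refine ⟨z / ‖z‖, ?_, ?_⟩
    · rw [star_div₀, Complex.star_def, Complex.conj_ofReal, div_mul_div_comm,
        h, ← sq, div_self (pow_ne_zero 2 hz')]
    · rw [star_div₀, Complex.star_def, Complex.conj_ofReal, div_mul_eq_mul_div,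
        h]
      norm_cast

/-- The phases of a unitary intertwiner on the summands can be chosen such that the coefficients
of a given triple next to the diagonal become real. -/
theorem exists_unitary_intertwiner_real (hn : 1 ≤ n) (hY : ∀ m, 1 ≤ m → IsIrrep m (Y m))
    (B : (m : ℕ) → Fin 3 → Matrix (Fin (m + 2)) (Fin m) ℂ)
    (e : Fin N ≃ Idx n k) {R : Fin 3 → Matrix (Fin N) (Fin N) ℂ} (hR : ∀ i, (R i)ᴴ = -R i)
    (h : RepEquiv R (chainRep n k Y)) (X : Fin 3 → Matrix (Fin N) (Fin N) ℂ) :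
    ∃ V : Matrix (Fin N) (Idx n k) ℂ, Vᴴ * V = 1 ∧ V * Vᴴ = 1 ∧
      (∀ i, R i * V = V * chainRep n k Y i) ∧
      ∀ a, (offCoeff B a (fun i => Vᴴ * X i * V)).im = 0 := by
  obtain ⟨V, h1, h2, h3⟩ := exists_unitary_intertwiner hn hY e hR h
  choose u hu1 hu2 using fun a => exists_phase (offCoeff B a (fun i => Vᴴ * X i * V))
  -- The coefficient `a` changes by the factor `conj (d (a + 1)) * d a`, which is `conj (u a)`.
  set d : ℕ → ℂ := fun a => ∏ j ∈ Finset.range a, u j with hd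
  have hd1 : ∀ a, star (d a) * d a = 1 := by
    intro a
    simp only [hd, star_prod, ← Finset.prod_mul_distrib, hu1, Finset.prod_const_one]
  have hD : (blockScalar n k d)ᴴ * blockScalar n k d = 1 := by
    simp only [blockScalar_conjTranspose, blockScalar_mul, hd1, blockScalar_one]
  have hV : (V * blockScalar n k d)ᴴ * (V * blockScalar n k d) = 1 := by
    rw [conjTranspose_mul, Matrix.mul_assoc, ← Matrix.mul_assoc Vᴴ, h1, Matrix.one_mul, hD]
  refine ⟨V * blockScalar n k d, hV, (mul_eq_one_comm_of_equiv e.symm).1 hV, fun i => ?_, fun a => ?_⟩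
  · rw [← Matrix.mul_assoc, h3, Matrix.mul_assoc, chainRep_mul_blockScalar, Matrix.mul_assoc]
  · have e1 : ∀ i, (V * blockScalar n k d)ᴴ * X i * (V * blockScalar n k d) =
        blockScalar n k (fun a => star (d a)) * (Vᴴ * X i * V) * blockScalar n k d := fun i => by
      rw [conjTranspose_mul, blockScalar_conjTranspose]
      simp only [Matrix.mul_assoc]
    have e2 : offCoeff B a (fun i => (V * blockScalar n k d)ᴴ * X i * (V * blockScalar n k d)) =
        star (u a) * offCoeff B a (fun i => Vᴴ * X i * V) := by
      have e3 : ∀ Z : Fin 3 → Matrix (Idx n k) (Idx n k) ℂ, offCoeff B a Z =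
          coord (B (n + 2 * a)) (fun i => blk (a + 1) a (Z i)) := fun _ => rfl
      rw [e3, e3]
      simp only [e1, blk_blockScalar_mul_mul]
      have e4 : star (d (a + 1)) * d a = star (u a) := by
        simp only [hd, Finset.prod_range_succ]
        rw [star_mul', mul_right_comm]
        rw [hd1 a, one_mul]
      rw [e4]
      exact (coord (B (n + 2 * a))).map_smul (star (u a)) (fun i => blk (a + 1) a (Vᴴ * X i * V))
    rw [e2]
    exact hu2 a

/-- A unitary matrix whose rows and columns are indexed differently becomes, after an
identification of the index sets and multiplication by a phase, a special unitary matrix that acts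
by the same conjugation. -/
theorem exists_specialUnitary {ι : Type*} [Fintype ι] [DecidableEq ι] (hN : N ≠ 0) (e : Fin N ≃ ι)
    {V : Matrix (Fin N) ι ℂ} (h1 : V * Vᴴ = 1) :
    ∃ U ∈ Matrix.specialUnitaryGroup (Fin N) ℂ,
      ∀ M : Matrix ι ι ℂ, V * M * Vᴴ = U * M.submatrix e e * U⁻¹ := by
  set W : Matrix (Fin N) (Fin N) ℂ := V.submatrix id e with hW
  have hWW : W * Wᴴ = 1 := by
    rw [hW, conjTranspose_submatrix, submatrix_mul_equiv, h1, submatrix_id_id]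
  have hdet : W.det * star W.det = 1 := by
    rw [← det_conjTranspose, ← det_mul, hWW, det_one]
  obtain ⟨w, hw⟩ := IsAlgClosed.exists_pow_nat_eq (star W.det) (Nat.pos_of_ne_zero hN)
  have hww : w * star w = 1 := by
    have h : (‖w‖ : ℝ) ^ N = 1 := by
      have h2 : ‖W.det‖ * ‖W.det‖ = 1 := by simpa using congrArg norm hdet
      have h3 : ‖W.det‖ = 1 := by nlinarith [norm_nonneg W.det]
      rw [← norm_pow, hw, norm_star, h3]
    have h4 : ‖w‖ = 1 := (pow_eq_one_iff_of_nonneg (norm_nonneg w) hN).1 h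
    rw [Complex.star_def, Complex.mul_conj', h4]
    simp
  have hU : (w • W) * (w • W)ᴴ = 1 := by
    rw [conjTranspose_smul, Matrix.smul_mul, Matrix.mul_smul, smul_smul, hWW, hww, one_smul]
  refine ⟨w • W, ?_, fun M => ?_⟩
  · rw [mem_specialUnitaryGroup_iff, mem_unitaryGroup_iff]
    refine ⟨hU, ?_⟩
    rw [det_smul, Fintype.card_fin, hw, mul_comm, hdet]
  · rw [inv_eq_right_inv hU, conjTranspose_smul, Matrix.smul_mul, Matrix.smul_mul, Matrix.mul_smul,
      smul_smul, hww, one_smul, hW, conjTranspose_submatrix, submatrix_mul_equiv,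
      submatrix_mul_equiv, submatrix_id_id]

end Gauge

/-! ### The reduction of Nahm's equations -/

section Nahm

variable {n k N : ℕ}

/-- The transformation `X ↦ V^* X V` of triples of matrices. -/
def gaugeMap (V : Matrix (Fin N) (Idx n k) ℂ) :
    (Fin 3 → Matrix (Fin N) (Fin N) ℂ) →ₗ[ℂ] (Fin 3 → Matrix (Idx n k) (Idx n k) ℂ) where
  toFun X i := Vᴴ * X i * V
  map_add' X X' := by funext i; simp [Matrix.mul_add, Matrix.add_mul]
  map_smul' c X := by funext i; simp

theorem gaugeMap_cross {V : Matrix (Fin N) (Idx n k) ℂ} (hV : V * Vᴴ = 1)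
    (X X' : Fin 3 → Matrix (Fin N) (Fin N) ℂ) :
    gaugeMap V (cross X X') = cross (gaugeMap V X) (gaugeMap V X') := by
  have h : ∀ A A' : Matrix (Fin N) (Fin N) ℂ, Vᴴ * A * V * (Vᴴ * A' * V) = Vᴴ * (A * A') * V := by
    intro A A'
    calc Vᴴ * A * V * (Vᴴ * A' * V) = Vᴴ * A * (V * Vᴴ) * A' * V := by
          simp only [Matrix.mul_assoc]
      _ = Vᴴ * (A * A') * V := by rw [hV, Matrix.mul_one]; simp only [Matrix.mul_assoc]
  funext i
  simp only [gaugeMap, LinearMap.coe_mk, AddHom.coe_mk, cross, h, Matrix.mul_sub, Matrix.sub_mul]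

theorem eq_mul_gaugeMap_mul {V : Matrix (Fin N) (Idx n k) ℂ} (hV : V * Vᴴ = 1)
    (X : Fin 3 → Matrix (Fin N) (Fin N) ℂ) (i : Fin 3) : X i = V * gaugeMap V X i * Vᴴ := by
  have : V * gaugeMap V X i * Vᴴ = (V * Vᴴ) * X i * (V * Vᴴ) := by
    simp only [gaugeMap, LinearMap.coe_mk, AddHom.coe_mk, Matrix.mul_assoc]
  rw [this, hV, Matrix.one_mul, Matrix.mul_one]

theorem IsGenerators.isVectorOp {I : Set ℝ} {T : Fin 3 → ℝ → Matrix (Fin N) (Fin N) ℂ}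
    {R : Fin 3 → Matrix (Fin N) (Fin N) ℂ} (h : IsGenerators I T R) {t : ℝ} (ht : t ∈ I) :
    IsVectorOp R R (fun i => T i t) := by
  have h2 := h.2 t ht
  simpa [IsVectorOp, Fin.forall_fin_succ, Fin.sum_univ_three, eps] using h2

theorem IsVectorOp.gaugeMap {R T : Fin 3 → Matrix (Fin N) (Fin N) ℂ} (h : IsVectorOp R R T)
    {C : Fin 3 → Matrix (Idx n k) (Idx n k) ℂ} {V : Matrix (Fin N) (Idx n k) ℂ}
    (h1 : Vᴴ * V = 1) (h2 : V * Vᴴ = 1) (hV : ∀ i, R i * V = V * C i) :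
    IsVectorOp C C (gaugeMap V T) := by
  refine h.mul_mul (fun i => ?_) hV
  calc Vᴴ * R i = Vᴴ * R i * (V * Vᴴ) := by rw [h2, Matrix.mul_one]
    _ = Vᴴ * (R i * V) * Vᴴ := by simp only [Matrix.mul_assoc]
    _ = (Vᴴ * V) * C i * Vᴴ := by rw [hV]; simp only [Matrix.mul_assoc]
    _ = C i * Vᴴ := by rw [h1, Matrix.one_mul]

/-- A linear functional on triples of matrices, as a continuous function of the entries. -/
def entryFunctional (L : (Fin 3 → Matrix (Fin N) (Fin N) ℂ) →ₗ[ℂ] ℂ) :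
    (Fin 3 → Fin N → Fin N → ℂ) →L[ℝ] ℂ :=
  LinearMap.toContinuousLinearMap
    { toFun := fun x => L fun i => of (x i)
      map_add' := fun x y => L.map_add (fun i => of (x i)) (fun i => of (y i))
      map_smul' := fun r x => L.map_smul_of_tower r (fun i => of (x i)) }

/-- The bilinear map whose quadratic form is the right-hand side of Nahm's equations. -/
def nahmBilin (N : ℕ) : (Fin 3 → Fin N → Fin N → ℂ) →L[ℝ] (Fin 3 → Fin N → Fin N → ℂ) →L[ℝ]
    (Fin 3 → Fin N → Fin N → ℂ) :=
  LinearMap.toContinuousBilinearMap <| LinearMap.mk₂ ℝ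
    (fun x y i p q => cross (fun i => of (x i)) (fun i => of (y i)) i p q)
    (fun x x' y => by
      funext i p q
      simp only [cross, Matrix.sub_apply, mul_apply, of_apply, Pi.add_apply, add_mul,
        Finset.sum_add_distrib]
      ring)
    (fun r x y => by
      funext i p q
      simp only [cross, Matrix.sub_apply, mul_apply, of_apply, Pi.smul_apply, smul_mul_assoc,
        ← Finset.smul_sum, smul_sub])
    (fun x y y' => by
      funext i p q
      simp only [cross, Matrix.sub_apply, mul_apply, of_apply, Pi.add_apply, mul_add,
        Finset.sum_add_distrib]
      ring)
    (fun r x y => by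
      funext i p q
      simp only [cross, Matrix.sub_apply, mul_apply, of_apply, Pi.smul_apply, mul_smul_comm,
        ← Finset.smul_sum, smul_sub])

variable {I : Set ℝ} {T : Fin 3 → ℝ → Matrix (Fin N) (Fin N) ℂ}

theorem SolvesNahm.hasDerivAt_entries (hT : SolvesNahm I T) {t : ℝ} (ht : t ∈ I) :
    HasDerivAt (fun s i p q => T i s p q)
      (fun i p q => cross (fun i => T i t) (fun i => T i t) i p q) t := by
  refine hasDerivAt_pi.2 fun i => hasDerivAt_pi.2 fun p => hasDerivAt_pi.2 fun q => ?_
  exact hT t ht i p q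

theorem SolvesNahm.analyticAt_entries (hT : SolvesNahm I T) (hI : IsOpen I) {t : ℝ} (ht : t ∈ I) :
    AnalyticAt ℝ (fun s i p q => T i s p q) t := by
  refine analyticAt_of_hasDerivAt_quadratic (nahmBilin N) ?_
  filter_upwards [hI.mem_nhds ht] with s hs
  exact hT.hasDerivAt_entries hs

theorem SolvesNahm.hasDerivAt_functional (hT : SolvesNahm I T) {t : ℝ} (ht : t ∈ I)
    (L : (Fin 3 → Matrix (Fin N) (Fin N) ℂ) →ₗ[ℂ] ℂ) :
    HasDerivAt (fun s => L fun i => T i s) (L (cross (fun i => T i t) (fun i => T i t))) t :=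
  (entryFunctional L).hasFDerivAt.comp_hasDerivAt t (hT.hasDerivAt_entries ht)

theorem SolvesNahm.analyticAt_functional (hT : SolvesNahm I T) (hI : IsOpen I) {t : ℝ}
    (ht : t ∈ I) (L : (Fin 3 → Matrix (Fin N) (Fin N) ℂ) →ₗ[ℂ] ℂ) :
    AnalyticAt ℝ (fun s => L fun i => T i s) t :=
  ((entryFunctional L).analyticAt _).comp (hT.analyticAt_entries hI ht)

theorem SolvesNahm.hasDerivAt_re (hT : SolvesNahm I T) {t : ℝ} (ht : t ∈ I)
    (L : (Fin 3 → Matrix (Fin N) (Fin N) ℂ) →ₗ[ℂ] ℂ) :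
    HasDerivAt (fun s => (L fun i => T i s).re)
      (L (cross (fun i => T i t) (fun i => T i t))).re t :=
  Complex.reCLM.hasFDerivAt.comp_hasDerivAt t (hT.hasDerivAt_functional ht L)

theorem SolvesNahm.hasDerivAt_im (hT : SolvesNahm I T) {t : ℝ} (ht : t ∈ I)
    (L : (Fin 3 → Matrix (Fin N) (Fin N) ℂ) →ₗ[ℂ] ℂ) :
    HasDerivAt (fun s => (L fun i => T i s).im)
      (L (cross (fun i => T i t) (fun i => T i t))).im t :=
  Complex.imCLM.hasFDerivAt.comp_hasDerivAt t (hT.hasDerivAt_functional ht L)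

theorem SolvesNahm.analyticOnNhd_re (hT : SolvesNahm I T) (hI : IsOpen I)
    (L : (Fin 3 → Matrix (Fin N) (Fin N) ℂ) →ₗ[ℂ] ℂ) :
    AnalyticOnNhd ℝ (fun s => (L fun i => T i s).re) I := fun _ ht =>
  (Complex.reCLM.analyticAt _).comp (hT.analyticAt_functional hI ht L)

/-- The reduction of a solution with the given symmetry, the summands being numbered by natural
numbers. The coefficients next to the diagonal are made real at one time; they stay real, because
each of them solves a linear differential equation with a real coefficient. -/
theorem exists_reduction (hn : 1 ≤ n) {Y : (m : ℕ) → Fin 3 → Matrix (Fin m) (Fin m) ℂ}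
    (hY : ∀ m, 1 ≤ m → IsIrrep m (Y m))
    {B : (m : ℕ) → Fin 3 → Matrix (Fin (m + 2)) (Fin m) ℂ}
    (hB : ∀ m, 1 ≤ m → IsInvariantTriple m (Y (m + 2)) (Y m) (B m))
    (e : Fin N ≃ Idx n k) (hIopen : IsOpen I) (hIconn : IsPreconnected I)
    (hTsu : ∀ t ∈ I, ∀ i, IsSu (T i t)) (hT : SolvesNahm I T)
    {R : Fin 3 → Matrix (Fin N) (Fin N) ℂ} (hR : IsGenerators I T R)
    (hRchain : RepEquiv R (chainRep n k Y)) :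
    ∃ V : Matrix (Fin N) (Idx n k) ℂ, Vᴴ * V = 1 ∧ V * Vᴴ = 1 ∧
      (∀ i, R i * V = V * chainRep n k Y i) ∧ ∃ f g : ℕ → ℝ → ℝ,
      (∀ a, AnalyticOnNhd ℝ (f a) I) ∧ (∀ a, AnalyticOnNhd ℝ (g a) I) ∧
      (∀ t ∈ I, ∀ i,
        T i t = V * chainMatrix n k Y B (fun a => f a t) (fun a => g a t) i * Vᴴ) ∧
      g k = 0 ∧
      (2 ≤ n → ∀ t ∈ I, HasDerivAt (f 0)
        (f 0 t ^ 2 - 2 * ((n : ℝ) + 2) / (n * (n + 1)) * g 0 t ^ 2) t) ∧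
      (∀ a, a + 1 ≤ k → ∀ t ∈ I, HasDerivAt (f (a + 1))
        (f (a + 1) t ^ 2 + 2 / ((n : ℝ) + 2 * (a + 1) - 1) * g a t ^ 2 -
          2 * ((n : ℝ) + 2 * (a + 1) + 2) / ((n + 2 * (a + 1)) * (n + 2 * (a + 1) + 1)) *
            g (a + 1) t ^ 2) t) ∧
      (∀ a, a + 1 ≤ k → ∀ t ∈ I, HasDerivAt (g a)
        ((((n : ℝ) + 2 * a + 3) / 2 * f (a + 1) t - ((n : ℝ) + 2 * a - 1) / 2 * f a t) *
          g a t) t) := by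
  -- The time at which the coefficients next to the diagonal are made real.
  obtain ⟨t₀, ht₀⟩ : ∃ t₀ : ℝ, I.Nonempty → t₀ ∈ I := by
    rcases I.eq_empty_or_nonempty with h | ⟨t₀, h⟩
    · exact ⟨0, by simp [h]⟩
    · exact ⟨t₀, fun _ => h⟩
  obtain ⟨V, hV1, hV2, hVR, hreal⟩ := exists_unitary_intertwiner_real hn hY B e
    (fun i => (hR.1 i).1) hRchain (fun i => T i t₀)
  set Lf : ℕ → (Fin 3 → Matrix (Fin N) (Fin N) ℂ) →ₗ[ℂ] ℂ :=
    fun a => diagCoeff Y a ∘ₗ gaugeMap V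
  set Lg : ℕ → (Fin 3 → Matrix (Fin N) (Fin N) ℂ) →ₗ[ℂ] ℂ :=
    fun a => offCoeff B a ∘ₗ gaugeMap V
  have hS : ∀ t ∈ I, IsVectorOp (chainRep n k Y) (chainRep n k Y) (gaugeMap V fun i => T i t) :=
    fun t ht => (hR.isVectorOp ht).gaugeMap hV1 hV2 hVR
  have hskew : ∀ t ∈ I, ∀ i,
      ((gaugeMap V fun i => T i t) i)ᴴ = -(gaugeMap V fun i => T i t) i := by
    intro t ht i
    simp only [gaugeMap, LinearMap.coe_mk, AddHom.coe_mk, conjTranspose_mul,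
      conjTranspose_conjTranspose, (hTsu t ht i).1, Matrix.neg_mul, Matrix.mul_neg,
      Matrix.mul_assoc]
  have hdf : ∀ a X, Lf a (cross X X) = diagCoeff Y a (cross (gaugeMap V X) (gaugeMap V X)) :=
    fun a X => by rw [← gaugeMap_cross hV2]; rfl
  have hdg : ∀ a X, Lg a (cross X X) = offCoeff B a (cross (gaugeMap V X) (gaugeMap V X)) :=
    fun a X => by rw [← gaugeMap_cross hV2]; rfl
  have hf : ∀ a ≤ k, ∀ t ∈ I, (((Lf a fun i => T i t).re : ℝ) : ℂ) =
      diagCoeff Y a (gaugeMap V fun i => T i t) := fun a ha t ht =>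
    Complex.conj_eq_iff_re.1 (star_diagCoeff hn hY (hS t ht) (hskew t ht) ha)
  have hdg' : ∀ a, a + 1 ≤ k → ∀ t ∈ I, Lg a (cross (fun i => T i t) (fun i => T i t)) =
      (((((n : ℝ) + 2 * a + 3) / 2 * (Lf (a + 1) fun i => T i t).re -
        ((n : ℝ) + 2 * a - 1) / 2 * (Lf a fun i => T i t).re : ℝ)) : ℂ) *
          Lg a fun i => T i t := by
    intro a ha t ht
    rw [hdg, offCoeff_eq (hB _ (by omega)).ne_zero (blk_cross_off hn hY hB (hS t ht) ha)]
    push_cast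
    rw [hf a (by omega) t ht, hf (a + 1) ha t ht]
    rfl
  have him : ∀ a, ∀ t ∈ I, (Lg a fun i => T i t).im = 0 := by
    intro a t ht
    by_cases ha : a + 1 ≤ k
    · refine eq_zero_of_hasDerivAt_mul hIconn (x := fun s => (Lg a fun i => T i s).im)
        (p := fun s => ((n : ℝ) + 2 * a + 3) / 2 * (Lf (a + 1) fun i => T i s).re -
          ((n : ℝ) + 2 * a - 1) / 2 * (Lf a fun i => T i s).re) ?_ (fun s hs => ?_) (ht₀ ⟨t, ht⟩)
        (hreal a) t ht
      · exact (continuousOn_const.mul (hT.analyticOnNhd_re hIopen _).continuousOn).sub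
          (continuousOn_const.mul (hT.analyticOnNhd_re hIopen _).continuousOn)
      · refine (hT.hasDerivAt_im hs (Lg a)).congr_deriv ?_
        rw [hdg' a ha s hs, Complex.im_ofReal_mul]
    · have : (Lg a fun i => T i t) = 0 := offCoeff_eq_zero (by omega)
      rw [this, Complex.zero_im]
  have hg : ∀ a, ∀ t ∈ I, (((Lg a fun i => T i t).re : ℝ) : ℂ) =
      offCoeff B a (gaugeMap V fun i => T i t) := fun a t ht =>
    Complex.ext rfl (him a t ht).symm
  have hgg : ∀ a, ∀ t ∈ I, star (offCoeff B a (gaugeMap V fun i => T i t)) *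
      offCoeff B a (gaugeMap V fun i => T i t) = (((Lg a fun i => T i t).re ^ 2 : ℝ) : ℂ) := by
    intro a t ht
    rw [← hg a t ht, Complex.star_def, Complex.conj_ofReal]
    push_cast
    ring
  refine ⟨V, hV1, hV2, hVR, fun a t => (Lf a fun i => T i t).re,
    fun a t => (Lg a fun i => T i t).re, fun a => hT.analyticOnNhd_re hIopen _,
    fun a => hT.analyticOnNhd_re hIopen _, fun t ht i => ?_, ?_, fun hn2 t ht => ?_,
    fun a ha t ht => ?_, fun a ha t ht => ?_⟩
  · rw [← eq_chainMatrix hn hY hB (hS t ht) (hskew t ht) _ _ (fun a ha => hf a ha t ht)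
      fun a _ => hg a t ht]
    exact eq_mul_gaugeMap_mul hV2 (fun i => T i t) i
  · funext t
    have : (Lg k fun i => T i t) = 0 := offCoeff_eq_zero le_rfl
    simp only [this, Complex.zero_re, Pi.zero_apply]
  · refine (hT.hasDerivAt_re ht (Lf 0)).congr_deriv ?_
    rw [hdf, diagCoeff_eq ((hY _ (by omega)).ne_zero (by omega))
      (blk_cross_zero hn hY hB (hS t ht) (hskew t ht)), hgg 0 t ht, ← hf 0 (by omega) t ht]
    refine (congrArg Complex.re ?_).trans (Complex.ofReal_re _)
    push_cast
    ring
  · refine (hT.hasDerivAt_re ht (Lf (a + 1))).congr_deriv ?_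
    rw [hdf, diagCoeff_eq ((hY _ (by omega)).ne_zero (by omega))
      (blk_cross_succ hn hY hB (hS t ht) (hskew t ht) ha), hgg a t ht, hgg (a + 1) t ht,
      ← hf (a + 1) ha t ht]
    refine (congrArg Complex.re ?_).trans (Complex.ofReal_re _)
    push_cast
    ring
  · refine (hT.hasDerivAt_re ht (Lg a)).congr_deriv ?_
    rw [hdg' a ha t ht, Complex.re_ofReal_mul]

end Nahm

end NahmChain

end

theorem mainTheorem3
    -- the chain of representations and the dimension of the space
    (n k N : ℕ) (hn : 1 ≤ n) (hk : 1 ≤ k)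
    -- unitary models of the irreducible representations and the invariant triples
    (Y : (m : ℕ) → Fin 3 → Matrix (Fin m) (Fin m) ℂ)
    (hY : ∀ m, 1 ≤ m → NahmChain.IsIrrep m (Y m))
    (B : (m : ℕ) → Fin 3 → Matrix (Fin (m + 2)) (Fin m) ℂ)
    (hB : ∀ m, 1 ≤ m → NahmChain.IsInvariantTriple m (Y (m + 2)) (Y m) (B m))
    -- any numbering of the rows and columns of the block matrices
    (e : Fin N ≃ NahmChain.Idx n k)
    -- a spherically symmetric solution to Nahm's equations on an open interval
    (I : Set ℝ) (hIopen : IsOpen I) (hIconn : IsPreconnected I)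
    (T : Fin 3 → ℝ → Matrix (Fin N) (Fin N) ℂ)
    (hTsu : ∀ t ∈ I, ∀ i, NahmChain.IsSu (T i t))
    (hT : NahmChain.SolvesNahm I T)
    (hTsymm : NahmChain.SphericallySymmetric I T)
    -- its generators, and the decomposition of the representation they induce
    (R : Fin 3 → Matrix (Fin N) (Fin N) ℂ)
    (hR : NahmChain.IsGenerators I T R)
    (hRrep : NahmChain.IsSo3Rep R)
    (hRchain : NahmChain.RepEquiv R (NahmChain.chainRep n k Y)) :
    ∃ U ∈ Matrix.specialUnitaryGroup (Fin N) ℂ, ∃ f g : ℤ → ℝ → ℝ,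
      -- the gauge is adapted to the decomposition
      (∀ i, R i = U * (NahmChain.chainRep n k Y i).submatrix e e * U⁻¹) ∧
      (∀ a : ℤ, 0 ≤ a → a ≤ k → AnalyticOnNhd ℝ (f a) I) ∧
      (∀ a : ℤ, 0 ≤ a → a < k → AnalyticOnNhd ℝ (g a) I) ∧
      (∀ t ∈ I, ∀ i, T i t =
        U * (NahmChain.chainMatrix n k Y B (fun a => f a t) (fun a => g a t) i).submatrix e e
          * U⁻¹) ∧
      -- the convention at the ends of the chain
      g (-1) = 0 ∧ g k = 0 ∧
      (n = 1 →
        (∀ i, Y 1 i = 0) ∧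
        (∀ a : ℤ, 1 ≤ a → a ≤ k → ∀ t ∈ I, HasDerivAt (f a)
          (f a t ^ 2 + 1 / (a : ℝ) * g (a - 1) t ^ 2
            - (2 * (a : ℝ) + 3) / ((2 * (a : ℝ) + 1) * ((a : ℝ) + 1)) * g a t ^ 2) t) ∧
        (∀ a : ℤ, 0 ≤ a → a < k → ∀ t ∈ I, HasDerivAt (g a)
          ((((a : ℝ) + 2) * f (a + 1) t - (a : ℝ) * f a t) * g a t) t)) ∧
      (2 ≤ n →
        (∀ a : ℤ, 0 ≤ a → a ≤ k → ∀ t ∈ I, HasDerivAt (f a)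
          (f a t ^ 2 + 2 / ((n : ℝ) + 2 * a - 1) * g (a - 1) t ^ 2
            - 2 * ((n : ℝ) + 2 * a + 2) / (((n : ℝ) + 2 * a) * ((n : ℝ) + 2 * a + 1))
              * g a t ^ 2) t) ∧
        (∀ a : ℤ, 0 ≤ a → a < k → ∀ t ∈ I, HasDerivAt (g a)
          ((((n : ℝ) + 2 * a + 3) / 2 * f (a + 1) t
            - ((n : ℝ) + 2 * a - 1) / 2 * f a t) * g a t) t)) := by
  obtain ⟨V, hV1, hV2, hVR, f, g, hfa, hga, hTV, hgk, hf0, hfs, hgs⟩ :=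
    NahmChain.exists_reduction hn hY hB e hIopen hIconn hTsu hT hR hRchain
  have hN : N ≠ 0 := by
    rintro rfl
    exact (e.symm ⟨0, ⟨0, by omega⟩⟩).elim0
  obtain ⟨U, hU, hUV⟩ := NahmChain.exists_specialUnitary hN e hV2
  have hneg : ∀ a : ℕ, ((a : ℤ) + 1).toNat = a + 1 := fun a => by omega
  refine ⟨U, hU, fun a => f a.toNat, fun a => if 0 ≤ a then g a.toNat else 0, fun i => ?_,
    fun a _ _ => hfa _, fun a ha _ => ?_, fun t ht i => ?_, by simp, by simpa using hgk,
    fun hn1 => ⟨fun i => ?_, fun a ha hak t ht => ?_, fun a ha hak t ht => ?_⟩,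
    fun hn2 => ⟨fun a ha hak t ht => ?_, fun a ha hak t ht => ?_⟩⟩
  · rw [← hUV, ← hVR, Matrix.mul_assoc, hV2, Matrix.mul_one]
  · simpa only [if_pos ha] using hga _
  · rw [hTV t ht i, ← hUV]
    simp
  · exact congrFun ((hY 1 le_rfl).eq_zero_of_le_one le_rfl) i
  · obtain ⟨b, rfl⟩ : ∃ b : ℕ, a = b + 1 := ⟨(a - 1).toNat, by omega⟩
    have h := hfs b (by omega) t ht
    have hb : (0 : ℤ) ≤ b + 1 := by omega
    simp only [hneg, hb, add_sub_cancel_right, Int.natCast_nonneg, if_true, Int.toNat_natCast]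
    refine h.congr_deriv ?_
    subst hn1
    have h1 : ((b : ℝ) + 1) ≠ 0 := by positivity
    have h2 : (2 * ((b : ℝ) + 1) + 1) ≠ 0 := by positivity
    have h3 : ((b : ℝ) + 1 + 1) ≠ 0 := by positivity
    push_cast
    rw [show (1 : ℝ) + 2 * (b + 1) - 1 = 2 * (b + 1) by ring,
      show (1 : ℝ) + 2 * (b + 1) + 1 = 2 * (b + 1 + 1) by ring,
      show (1 : ℝ) + 2 * (b + 1) = 2 * (b + 1) + 1 by ring]
    field_simp
    ring
  · lift a to ℕ using ha
    have h := hgs a (by omega) t ht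
    simp only [hneg, Int.natCast_nonneg, if_true, Int.toNat_natCast]
    refine h.congr_deriv ?_
    subst hn1
    push_cast
    ring
  · rcases ha.eq_or_lt with rfl | ha0
    · simpa using hf0 hn2 t ht
    · obtain ⟨b, rfl⟩ : ∃ b : ℕ, a = b + 1 := ⟨(a - 1).toNat, by omega⟩
      have h := hfs b (by omega) t ht
      have hb : (0 : ℤ) ≤ b + 1 := by omega
      simp only [hneg, hb, add_sub_cancel_right, Int.natCast_nonneg, if_true, Int.toNat_natCast]
      refine h.congr_deriv ?_
      push_cast
      ring
  · lift a to ℕ using ha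
    have h := hgs a (by omega) t ht
    simpa only [hneg, Int.natCast_nonneg, if_true, Int.toNat_natCast, Int.cast_natCast] using h
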